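/- \textbf{Setting.} Let $X\subset\mathbb P^N$ be a smooth projective variety over $\mathbb C$ of dimension $n$, with homogeneous coordinate ring $R=\bigoplus_{k\ge 0}R_k$, $L=R_1$, $R_k=L^k$ (for instance $X$ embedded by the sections $L=H^0(X,\mathcal L)$ of a very ample line bundle $\mathcal L$). Let $v:\mathbb C(X)\setminus\{0\}\to\mathbb Z^n$ ($\mathbb Z^n$ with the lexicographic order) be a valuation with one-dimensional leaves: $v(fg)=v(f)+v(g)$, $v(f+g)\ge\min(v(f),v(g))$, $v(\lambda f)=v(f)$ for $\lambda\in\mathbb C^*$, and whenever $v(f)=v(g)$ there is $\lambda\in\mathbb C^*$ with $g=\lambda f$ or $v(g-\lambda f)>v(g)$. Fix $0\ne h\in L$ and assume that the value semigroup $S=\bigcup_{k>0}\{(k,v(f/h^k)) : 0\neq f\in R_k\}\subset\mathbb Z\times\mathbb Z^n$ is finitely generated. \textbf{Construction.} Order $\mathbb Z\times\mathbb Z^n$ by $(m,u)<(m',u')$ iff $m<m'$, or $m=m'$ and $u>u'$ lexicographically. A SAGBI basis consists of an integer $r\geq 1$ and, for each $1\le i\le r$, a vector space basis $f_{i1},\dots,f_{in_i}$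 of $R_i$, such that the vectors $(i,u_{ij})$, $u_{ij}=v(f_{ij}/h^i)$, generate the semigroup $S$. Let $A=\mathbb C[x_{ij}]$ be graded by $\deg x_{ij}=(i,u_{ij})$, and let $I_0\subset A$ be the kernel of the homomorphism $x_{ij}\mapsto \overline f_{ij}$ to the associated graded ring $\operatorname{gr}R$ of $R$, i.e. the ideal spanned by those homogeneous $F$ (of degree $(m,u)$, say) with $F(f_{ij})=0$ or $v(F(f_{ij})/h^m)>u$. Let $\overline g_1,\dots,\overline g_q$ be nonzero homogeneous generators of $I_0$, $\deg\overline g_k=(n_k,v_k)$, and let $g_k\in A$ be homogeneous for the grading $\deg x_{ij}=i$, with $g_k(f_{ij})=0$ and such that all monomials of $g_k-\overline g_k$ have degree $<(n_k,v_k)$. Let $\mathcal S$ be the finite set of the degrees of all monomials that occur in the $g_k$. A weight projection is a linear map $p:\mathbb Z\times\mathbb Z^n\to\mathbb Z$ that strictly preserves the order on $\mathcal S$ and for which all $w_{ij}=p(i,u_{ij})$ are $\ge 0$. With $\ell_k=p(n_k,v_k)$ put $$\tilde g_k(x,t)=t^{\ell_k}g_k(t^{-w_{ij}}x_{ij})=\sum_{q\ge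 0}h_{k,q}(x)\,t^q .$$ Let $W\mathbb P$ be the weighted projective space with coordinates $x_{ij}$ of weight $i$, let $\mathfrak X\subset W\mathbb P\times\mathbb C$ be the zero set of $\tilde g_1,\dots,\tilde g_q$ with its structure of a (reduced) variety, $\pi:\mathfrak X\to\mathbb C$ the projection, and $X_0=\pi^{-1}(0)$, regarded as a (reduced) variety. \textbf{Statement.} A SAGBI basis exists; for every SAGBI basis, polynomials $\overline g_k,g_k$ as above exist; and for every such choice of $f_{ij},\overline g_k,g_k$ there is a weight projection $p$ such that \begin{itemize} \item[(1)] $p(a)>1$ for all $0\ne a\in\mathcal S$; \item[(2)] $h_{k,1}=0$ for every $k$; \item[(3)] $\pi:\mathfrak X\to\mathbb C$ has no critical point on the smooth locus of $X_0$: at every smooth point $P$ of $X_0$ the differential of $\pi$ on the (Zariski) tangent space $T_P\mathfrak X$ is nonzero. \end{itemize} -/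

import Mathlib

open MvPolynomial

noncomputable section

/-! ### Local rings of closed subsets of weighted projective spaces

`k[z_i]` is graded by `deg z_i = m i`, where `m i = 0` is allowed: variables of weight zero are
coordinates on an affine factor. -/

/-- The prime ideal of all polynomials vanishing at `z`. -/
def pointIdeal {τ : Type} (z : τ → ℂ) : Ideal (MvPolynomial τ ℂ) :=
  RingHom.ker (MvPolynomial.eval z)

instance pointIdeal_isPrime {τ : Type} (z : τ → ℂ) : (pointIdeal z).IsPrime :=
  RingHom.ker_isPrime _

attribute [local instance] MvPolynomial.weightedGradedAlgebra

/-- The local ring of the ambient weighted projective space at the class of `z`: quotients `F / G`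
of weighted homogeneous polynomials of the same degree, with `G z ≠ 0`. -/
abbrev AmbientLocalRing {τ : Type} (m : τ → ℕ) (z : τ → ℂ) : Type :=
  HomogeneousLocalization.AtPrime (weightedHomogeneousSubmodule ℂ m) (pointIdeal z)

/-- The ideal of the germs in `AmbientLocalRing m z` that vanish on `Z`, where `Z` is (the cone over)
a closed subset: the degree zero part of the localization of the vanishing ideal of `Z`. -/
def germIdeal {τ : Type} (m : τ → ℕ) (Z : Set (τ → ℂ)) (z : τ → ℂ) :
    Ideal (AmbientLocalRing m z) :=
  ((MvPolynomial.vanishingIdeal ℂ Z).map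
      (algebraMap (MvPolynomial τ ℂ) (Localization.AtPrime (pointIdeal z)))).comap
    (algebraMap (AmbientLocalRing m z) (Localization.AtPrime (pointIdeal z)))

/-- The local ring at the class of `z` of the closed subset (reduced variety) with cone `Z`. -/
abbrev VarietyLocalRing {τ : Type} (m : τ → ℕ) (Z : Set (τ → ℂ)) (z : τ → ℂ) : Type :=
  AmbientLocalRing m z ⧸ germIdeal m Z z

/-- A polynomial of weighted degree zero (for instance a coordinate of weight zero), as an element
of the ambient local ring. -/
def regularGerm {τ : Type} (m : τ → ℕ) (z : τ → ℂ) (F : weightedHomogeneousSubmodule ℂ m 0) :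
    AmbientLocalRing m z :=
  algebraMap (weightedHomogeneousSubmodule ℂ m 0) (AmbientLocalRing m z) F

/-! ### Projective varieties, their coordinate rings and function fields -/

/-- A closed subvariety of `ℙ^N` over `ℂ`, given by its homogeneous prime ideal. -/
structure ProjectiveVariety (N : ℕ) where
  ideal : Ideal (MvPolynomial (Fin (N + 1)) ℂ)
  isPrime : ideal.IsPrime
  isHomogeneous : ∀ F ∈ ideal, ∀ k : ℕ, homogeneousComponent k F ∈ ideal
  exists_coordinate_notMem : ∃ i, (X i : MvPolynomial (Fin (N + 1)) ℂ) ∉ ideal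

namespace ProjectiveVariety

variable {N : ℕ} (V : ProjectiveVariety N)

instance : V.ideal.IsPrime := V.isPrime

/-- The homogeneous coordinate ring `R = ⨁ R_k` of the embedded variety. -/
abbrev coordRing : Type := MvPolynomial (Fin (N + 1)) ℂ ⧸ V.ideal

/-- The graded piece `R_k = L ^ k`, where `L = R_1` is the space of sections of the hyperplane
bundle cut out by linear forms. -/
def piece (k : ℕ) : Submodule ℂ V.coordRing :=
  (homogeneousSubmodule (Fin (N + 1)) ℂ k).map (Ideal.Quotient.mkₐ ℂ V.ideal).toLinearMap

theorem one_mem_piece : (1 : V.coordRing) ∈ V.piece 0 :=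
  ⟨1, isHomogeneous_one _ _, map_one (Ideal.Quotient.mkₐ ℂ V.ideal)⟩

theorem mul_mem_piece {k l : ℕ} {a b : V.coordRing} (ha : a ∈ V.piece k) (hb : b ∈ V.piece l) :
    a * b ∈ V.piece (k + l) := by
  obtain ⟨F, hF, rfl⟩ := ha
  obtain ⟨G, hG, rfl⟩ := hb
  exact ⟨F * G, IsHomogeneous.mul hF hG, map_mul (Ideal.Quotient.mkₐ ℂ V.ideal) F G⟩

theorem pow_mem_piece {a : V.coordRing} (ha : a ∈ V.piece 1) (k : ℕ) : a ^ k ∈ V.piece k := by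
  induction k with
  | zero => simpa using V.one_mem_piece
  | succ k ih => rw [pow_succ]; exact V.mul_mem_piece ih ha

/-- The function field `ℂ(X)`: all quotients `a / b` with `a, b` in the same `R_k`. -/
def functionField : IntermediateField ℂ (FractionRing V.coordRing) where
  carrier := {q | ∃ k : ℕ, ∃ a ∈ V.piece k, ∃ b ∈ V.piece k, b ≠ 0 ∧
    q = algebraMap V.coordRing (FractionRing V.coordRing) a /
      algebraMap V.coordRing (FractionRing V.coordRing) b}
  mul_mem' := by
    rintro _ _ ⟨k, a, ha, b, hb, hb0, rfl⟩ ⟨l, c, hc, d, hd, hd0, rfl⟩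
    exact ⟨k + l, a * c, V.mul_mem_piece ha hc, b * d, V.mul_mem_piece hb hd,
      mul_ne_zero hb0 hd0, by rw [div_mul_div_comm, map_mul, map_mul]⟩
  add_mem' := by
    rintro _ _ ⟨k, a, ha, b, hb, hb0, rfl⟩ ⟨l, c, hc, d, hd, hd0, rfl⟩
    have hb1 : algebraMap V.coordRing (FractionRing V.coordRing) b ≠ 0 := by simpa using hb0
    have hd1 : algebraMap V.coordRing (FractionRing V.coordRing) d ≠ 0 := by simpa using hd0
    refine ⟨k + l, a * d + b * c, add_mem (V.mul_mem_piece ha hd) (V.mul_mem_piece hb hc),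
      b * d, V.mul_mem_piece hb hd, mul_ne_zero hb0 hd0, ?_⟩
    rw [div_add_div _ _ hb1 hd1, map_add, map_mul, map_mul, map_mul]
  algebraMap_mem' := by
    intro c
    refine ⟨0, c • 1, Submodule.smul_mem _ _ V.one_mem_piece, 1, V.one_mem_piece, one_ne_zero, ?_⟩
    rw [map_one, div_one, ← Algebra.algebraMap_eq_smul_one,
      ← IsScalarTower.algebraMap_apply]
  inv_mem' := by
    rintro _ ⟨k, a, ha, b, hb, hb0, rfl⟩
    by_cases ha0 : a = 0
    · exact ⟨0, 0, zero_mem _, 1, V.one_mem_piece, one_ne_zero, by simp [ha0]⟩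
    · exact ⟨k, b, hb, a, ha, ha0, by rw [inv_div]⟩

/-- The rational function `f / h ^ k` attached to a section `f ∈ R_k` and a reference section
`h ∈ L`, `h ≠ 0`. -/
def ratio (h : V.piece 1) {k : ℕ} (f : V.piece k) : V.functionField :=
  ⟨algebraMap V.coordRing (FractionRing V.coordRing) f /
      algebraMap V.coordRing (FractionRing V.coordRing) ((h : V.coordRing) ^ k), by
    by_cases hk : (h : V.coordRing) ^ k = 0
    · rw [hk, map_zero, div_zero]; exact zero_mem _
    · exact ⟨k, f, f.2, _, V.pow_mem_piece h.2 k, hk, rfl⟩⟩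

/-- `V` is smooth: its local rings at all points are regular. -/
def IsSmooth : Prop :=
  ∀ z ∈ zeroLocus ℂ V.ideal, z ≠ 0 →
    IsRegularLocalRing (VarietyLocalRing (fun _ => 1) (zeroLocus ℂ V.ideal) z)

end ProjectiveVariety

/-! ### Valuations and value semigroups -/

/-- A valuation on `K ∖ {0}` with values in `ℤ^n`, ordered lexicographically. The value of `toFun`
at `0` plays no role. -/
structure LatticeValuation (n : ℕ) (K : Type) [Field K] [Algebra ℂ K] where
  toFun : K → (Fin n → ℤ)
  map_mul : ∀ f g : K, f ≠ 0 → g ≠ 0 → toFun (f * g) = toFun f + toFun g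
  map_add : ∀ f g : K, f ≠ 0 → g ≠ 0 → f + g ≠ 0 →
    min (toLex (toFun f)) (toLex (toFun g)) ≤ toLex (toFun (f + g))
  map_smul : ∀ (c : ℂ) (f : K), c ≠ 0 → f ≠ 0 → toFun (c • f) = toFun f

/-- One-dimensional leaves. -/
def LatticeValuation.HasOneDimLeaves {n : ℕ} {K : Type} [Field K] [Algebra ℂ K]
    (v : LatticeValuation n K) : Prop :=
  ∀ f g : K, f ≠ 0 → g ≠ 0 → v.toFun f = v.toFun g →
    ∃ c : ℂ, c ≠ 0 ∧ (g - c • f = 0 ∨ toLex (v.toFun g) < toLex (v.toFun (g - c • f)))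

namespace ProjectiveVariety

variable {N n : ℕ} (V : ProjectiveVariety N)

/-- The extended valuation on homogeneous elements: `f ↦ (k, v (f / h ^ k))` for `f ∈ R_k`. -/
def gradedValue (v : LatticeValuation n V.functionField) (h : V.piece 1) {k : ℕ}
    (f : V.piece k) : ℤ × (Fin n → ℤ) :=
  ((k : ℤ), v.toFun (V.ratio h f))

/-- The value semigroup `S = ⋃_{k > 0} {(k, v (f / h ^ k)) | f ∈ R_k ∖ {0}}`. -/
def valueSemigroup (v : LatticeValuation n V.functionField) (h : V.piece 1) :
    Set (ℤ × (Fin n → ℤ)) :=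
  {s | ∃ k : ℕ, 0 < k ∧ ∃ f : V.piece k, f ≠ 0 ∧ s = V.gradedValue v h f}

/-- `S` is finitely generated as a semigroup. -/
def FinitelyGeneratedValues (v : LatticeValuation n V.functionField) (h : V.piece 1) : Prop :=
  ∃ T : Finset (ℤ × (Fin n → ℤ)),
    (AddSubsemigroup.closure (T : Set (ℤ × (Fin n → ℤ))) : Set (ℤ × (Fin n → ℤ))) =
      V.valueSemigroup v h

end ProjectiveVariety

/-- The total order on `ℤ × ℤ^n` used to select leading terms: first by degree and then by the
*reversed* lexicographic order, so that smaller values of the valuation lead. -/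
def degreeLT {n : ℕ} (a b : ℤ × (Fin n → ℤ)) : Prop :=
  a.1 < b.1 ∨ (a.1 = b.1 ∧ toLex b.2 < toLex a.2)

/-! ### The degeneration -/

/-- A SAGBI basis `f_{ij}`, `1 ≤ i ≤ r`, `1 ≤ j ≤ n_i`: for each `i` the `f_{ij}` form a basis of
`R_i`, and the values of all `f_{ij}` generate `S`. The index `i : Fin r` stands for `i + 1`. -/
structure SagbiBasis {N n : ℕ} (V : ProjectiveVariety N)
    (v : LatticeValuation n V.functionField) (h : V.piece 1) where
  r : ℕ
  r_pos : 0 < r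
  size : Fin r → ℕ
  basis : ∀ i : Fin r, Module.Basis (Fin (size i)) ℂ (V.piece ((i : ℕ) + 1))
  closure_eq : (AddSubsemigroup.closure
      (Set.range fun ij : Σ i : Fin r, Fin (size i) => V.gradedValue v h (basis ij.1 ij.2)) :
        Set (ℤ × (Fin n → ℤ))) = V.valueSemigroup v h

/-- The set underlying weighted projective space: nonzero vectors up to
`x_i ∼ c ^ (m i) x_i`, `c ∈ ℂ^*`. -/
def weightedSetoid {σ : Type} (m : σ → ℕ) : Setoid {x : σ → ℂ // x ≠ 0} where
  r x y := ∃ c : ℂ, c ≠ 0 ∧ ∀ i, y.1 i = c ^ m i * x.1 i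
  iseqv :=
    { refl := fun x => ⟨1, one_ne_zero, fun i => by simp⟩
      symm := by
        rintro x y ⟨c, hc, h⟩
        refine ⟨c⁻¹, inv_ne_zero hc, fun i => ?_⟩
        rw [h i, inv_pow, inv_mul_cancel_left₀ (pow_ne_zero _ hc)]
      trans := by
        rintro x y z ⟨c, hc, h⟩ ⟨d, hd, h'⟩
        refine ⟨d * c, mul_ne_zero hd hc, fun i => ?_⟩
        rw [h' i, h i, mul_pow, mul_assoc] }

/-- Weighted projective space over `ℂ` with weights `m`. -/
def WeightedProjectiveSpace {σ : Type} (m : σ → ℕ) : Type := Quotient (weightedSetoid m)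

/-- Weights on the variables of `WP × ℂ`; the coordinate `t = none` of the second factor has
weight `0`. -/
def extendedWeight {σ : Type} (m : σ → ℕ) : Option σ → ℕ := fun o => o.elim 0 m

/-- `(x, t)` are homogeneous coordinates of the point `P` of `WP × ℂ`. -/
def IsCoordinates {σ : Type} {m : σ → ℕ} (z : Option σ → ℂ)
    (P : WeightedProjectiveSpace m × ℂ) : Prop :=
  ∃ hx : (fun i => z (some i)) ≠ 0,
    P = (Quotient.mk (weightedSetoid m) ⟨fun i => z (some i), hx⟩, z none)

/-- All homogeneous coordinates of points of `Z ⊆ WP × ℂ`. -/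
def coneOver {σ : Type} {m : σ → ℕ} (Z : Set (WeightedProjectiveSpace m × ℂ)) :
    Set (Option σ → ℂ) :=
  {z | ∃ P ∈ Z, IsCoordinates z P}

/-- `P` is a smooth point of the closed subvariety `Z` of `WP × ℂ`. -/
def IsSmoothPoint {σ : Type} {m : σ → ℕ} (Z : Set (WeightedProjectiveSpace m × ℂ))
    (P : WeightedProjectiveSpace m × ℂ) : Prop :=
  P ∈ Z ∧ ∃ z, IsCoordinates z P ∧
    IsRegularLocalRing (VarietyLocalRing (extendedWeight m) (coneOver Z) z)

/-- The function `t - t(z)` on `WP × ℂ`, of weighted degree `0`. -/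
def parameterAt {σ : Type} (m : σ → ℕ) (z : Option σ → ℂ) :
    weightedHomogeneousSubmodule ℂ (extendedWeight m) 0 :=
  ⟨X none - C (z none),
    sub_mem (isWeightedHomogeneous_X ℂ (extendedWeight m) none)
      (isWeightedHomogeneous_C (extendedWeight m) (z none))⟩

/-- `P` is a critical point of the projection `π : Z → ℂ`, `(x, t) ↦ t`: the differential of `π` on
the Zariski tangent space of `Z` at `P` is zero, i.e. `π - π(P)` lies in the square of the maximal
ideal of the local ring of `Z` at `P`. -/
def IsCriticalPoint {σ : Type} {m : σ → ℕ} (Z : Set (WeightedProjectiveSpace m × ℂ))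
    (P : WeightedProjectiveSpace m × ℂ) : Prop :=
  P ∈ Z ∧ ∃ z, IsCoordinates z P ∧
    Ideal.Quotient.mk (germIdeal (extendedWeight m) (coneOver Z) z)
        (regularGerm (extendedWeight m) z (parameterAt m z)) ∈
      ((IsLocalRing.maximalIdeal (AmbientLocalRing (extendedWeight m) z)).map
        (Ideal.Quotient.mk (germIdeal (extendedWeight m) (coneOver Z) z))) ^ 2

namespace SagbiBasis

variable {N n : ℕ} {V : ProjectiveVariety N} {v : LatticeValuation n V.functionField}
  {h : V.piece 1} (B : SagbiBasis V v h)

/-- The index set of pairs `(i, j)`. -/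
abbrev Index : Type := Σ i : Fin B.r, Fin (B.size i)

/-- The element `f_{ij}` of `R`. -/
def elt (ij : B.Index) : V.coordRing := B.basis ij.1 ij.2

/-- The weight `i` of the variable `x_{ij}`. -/
def weight (ij : B.Index) : ℕ := (ij.1 : ℕ) + 1

/-- The degree `(i, u_{ij})` of the variable `x_{ij}`. -/
def degree (ij : B.Index) : ℤ × (Fin n → ℤ) := V.gradedValue v h (B.basis ij.1 ij.2)

/-- The kernel `I_0` of `A = ℂ[x_{ij}] → gr R`. It is the ideal generated by its homogeneous
elements, and a homogeneous `F` of degree `(m, u)` maps to the class of `F(f) ∈ R_m` in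
`R_{≥ (m, u)} / R_{> (m, u)}`, which vanishes iff `F(f) = 0` or `v (F(f) / h ^ m) > u`. -/
def initialIdeal : Ideal (MvPolynomial B.Index ℂ) :=
  Ideal.span {F | ∃ (m : ℕ) (u : Fin n → ℤ), IsWeightedHomogeneous B.degree F ((m : ℤ), u) ∧
    ∃ a : V.piece m, aeval B.elt F = (a : V.coordRing) ∧
      (a = 0 ∨ toLex u < toLex (v.toFun (V.ratio h a)))}

/-- Homogeneous generators `gbar_k`, of degree `deg k = (n_k, v_k)`, of the ideal `I_0`, together
with lifts `g_k`: relations among the `f_{ij}`, homogeneous for the `ℕ`-grading, that differ from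
`gbar_k` by terms of degree lower than `(n_k, v_k)`. -/
structure Relations where
  q : ℕ
  deg : Fin q → ℤ × (Fin n → ℤ)
  gbar : Fin q → MvPolynomial B.Index ℂ
  gbar_ne_zero : ∀ k, gbar k ≠ 0
  gbar_homogeneous : ∀ k, IsWeightedHomogeneous B.degree (gbar k) (deg k)
  span_gbar : Ideal.span (Set.range gbar) = B.initialIdeal
  g : Fin q → MvPolynomial B.Index ℂ
  aeval_g : ∀ k, aeval B.elt (g k) = 0
  g_homogeneous : ∀ k, ∃ d : ℕ, IsWeightedHomogeneous B.weight (g k) d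
  g_lower : ∀ k, ∀ α ∈ (g k - gbar k).support, degreeLT (Finsupp.weight B.degree α) (deg k)

namespace Relations

variable {B} (D : B.Relations)

/-- The finite set of the degrees of all monomials that appear in some `g_k`. -/
def monomialDegrees : Set (ℤ × (Fin n → ℤ)) :=
  {a | ∃ k, ∃ α ∈ (D.g k).support, a = Finsupp.weight B.degree α}

/-- `p` is a projection that can be used in the construction: it strictly preserves the order on the
degrees of the monomials of the `g_k`, and the weights `w_{ij} = p (i, u_{ij})` are nonnegative, so
that `x_{ij} ↦ t ^ w_{ij} f_{ij}` has values in `R[t]`. -/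
def IsWeightProjection (p : (ℤ × (Fin n → ℤ)) →ₗ[ℤ] ℤ) : Prop :=
  (∀ a ∈ D.monomialDegrees, ∀ b ∈ D.monomialDegrees, degreeLT a b → p a < p b) ∧
    ∀ ij : B.Index, 0 ≤ p (B.degree ij)

/-- The deformed relation `g̃_k = t ^ ℓ_k g_k (t ^ (-w_{ij}) x_{ij}) = ∑_q h_{k,q} t ^ q`, where
`ℓ_k = p (n_k, v_k)` and `w_{ij} = p (i, u_{ij})`, as a polynomial in `t` over `ℂ[x_{ij}]`. The
monomial `x ^ α` gets the exponent `ℓ_k - w · α`, which is nonnegative for a weight projection `p`. -/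
def deformed (p : (ℤ × (Fin n → ℤ)) →ₗ[ℤ] ℤ) (k : Fin D.q) :
    Polynomial (MvPolynomial B.Index ℂ) :=
  ∑ α ∈ (D.g k).support, Polynomial.monomial
    (p (D.deg k) - α.sum fun ij e => (e : ℤ) * p (B.degree ij)).toNat
    (MvPolynomial.monomial α ((D.g k).coeff α))

/-- The family `𝔛 ⊆ WP × ℂ`: the zero set of the deformed relations. -/
def family (p : (ℤ × (Fin n → ℤ)) →ₗ[ℤ] ℤ) : Set (WeightedProjectiveSpace B.weight × ℂ) :=
  {P | ∃ z : Option B.Index → ℂ, IsCoordinates z P ∧ ∀ k,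
    ((D.deformed p k).map (MvPolynomial.eval fun ij => z (some ij))).eval (z none) = 0}

/-- The special fibre `X_0 = π⁻¹(0)`, with its structure of a (reduced) variety. -/
def specialFiber (p : (ℤ × (Fin n → ℤ)) →ₗ[ℤ] ℤ) :
    Set (WeightedProjectiveSpace B.weight × ℂ) :=
  {P | P ∈ D.family p ∧ P.2 = 0}

end Relations

end SagbiBasis

end

noncomputable section

attribute [local instance] MvPolynomial.weightedGradedAlgebra

namespace ProjectiveVariety

variable {N n : ℕ} (V : ProjectiveVariety N)

/-! ### Values of homogeneous elements -/

section Ratio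

variable {h : V.piece 1} (hh : h ≠ 0)
include hh

/-! Everything about the parameter `t` comes from one device: take any order-preserving projection
and double it. All exponents `ℓ_k - w·α` are then even, so `t` never occurs to the first power in a
deformed relation, and positive values become at least 2 (`exists_even_weightProjection`,
`coeff_one_deformed`). At a point `(z, 0)` of the family, substituting `t = ε` with `ε² = 0` turns
each deformed relation into its value at `(z, 0)`, which is zero. So `∂/∂t` kills all relations,
while it sends `π = t` to `ε ≠ 0`.

For `∂/∂t` to be tangent to the reduced variety, every polynomial vanishing on the family must lie
in the ideal of the deformed relations. Two facts give this. Such a polynomial vanishes at the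
points `(t^w y(f), t)` with `t ≠ 0` and `y` a point of the cone over `X`, hence dies under `x_ij ↦
t^w_ij f_ij` (`reesMap_eq_zero_of_mem_vanishingIdeal`). The kernel of that map is in turn generated
by the deformed relations (`mem_familyIdeal_of_reesMap_eq_zero`): they rewrite every monomial
through one chosen monomial per degree, and the chosen ones have independent images because their
degrees and values are distinct.

Existence of SAGBI bases and of the lifts `g_k` rests on subduction (`le_of_forall_exists_value`):
one-dimensional leaves allow a leading term to be cancelled, and the process stops because only
finitely many values occur on `R_k`. -/

theorem pow_reference_ne_zero (k : ℕ) : (h : V.coordRing) ^ k ≠ 0 :=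
  pow_ne_zero _ (by simpa using hh)

theorem algebraMap_pow_reference_ne_zero (k : ℕ) :
    algebraMap V.coordRing (FractionRing V.coordRing) ((h : V.coordRing) ^ k) ≠ 0 := by
  simpa using V.pow_reference_ne_zero hh k

theorem ratio_ne_zero {k : ℕ} {a : V.piece k} (ha : a ≠ 0) : V.ratio h a ≠ 0 := by
  intro h0
  have h1 := congrArg (Subtype.val) h0
  have h2 := div_eq_zero_iff.1 h1
  rcases h2 with h2 | h2
  · exact ha (by simpa using h2)
  · exact V.algebraMap_pow_reference_ne_zero hh k h2

end Ratio

theorem ratio_add (h : V.piece 1) {k : ℕ} (a b : V.piece k) :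
    V.ratio h (a + b) = V.ratio h a + V.ratio h b :=
  Subtype.ext (by simp [ratio, add_div])

theorem ratio_smul (h : V.piece 1) {k : ℕ} (c : ℂ) (a : V.piece k) :
    V.ratio h (c • a) = c • V.ratio h a := by
  apply Subtype.ext
  show algebraMap V.coordRing (FractionRing V.coordRing) (c • (a : V.coordRing)) / _ =
    c • (algebraMap V.coordRing (FractionRing V.coordRing) a / _)
  rw [Algebra.smul_def c (a : V.coordRing), map_mul, Algebra.smul_def, mul_div_assoc,
    ← IsScalarTower.algebraMap_apply]

theorem ratio_mul (h : V.piece 1) {k l : ℕ} (a : V.piece k) (b : V.piece l) :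
    V.ratio h (⟨a * b, V.mul_mem_piece a.2 b.2⟩ : V.piece (k + l)) =
      V.ratio h a * V.ratio h b :=
  Subtype.ext (by
    show _ / _ = _ / _ * (_ / _)
    rw [div_mul_div_comm, pow_add, map_mul, map_mul])

variable (v : LatticeValuation n V.functionField) (h : V.piece 1)

open Classical in
/-- The value `v (a / h ^ k)` of an element `a` of `R_k`, with value `0` for `a ∉ R_k`. -/
def value (k : ℕ) (a : V.coordRing) : Fin n → ℤ :=
  if ha : a ∈ V.piece k then v.toFun (V.ratio h ⟨a, ha⟩) else 0

variable {V}

theorem value_of_mem {k : ℕ} {a : V.coordRing} (ha : a ∈ V.piece k) :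
    V.value v h k a = v.toFun (V.ratio h ⟨a, ha⟩) := dif_pos ha

theorem value_coe {k : ℕ} (a : V.piece k) : V.value v h k a = v.toFun (V.ratio h a) :=
  value_of_mem v h a.2

variable {h} (hh : h ≠ 0)
include hh

theorem value_mul {k l : ℕ} {a b : V.coordRing} (ha : a ∈ V.piece k) (hb : b ∈ V.piece l)
    (ha0 : a ≠ 0) (hb0 : b ≠ 0) :
    V.value v h (k + l) (a * b) = V.value v h k a + V.value v h l b := by
  rw [value_of_mem v h ha, value_of_mem v h hb, value_of_mem v h (V.mul_mem_piece ha hb)]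
  have := V.ratio_mul h ⟨a, ha⟩ ⟨b, hb⟩
  rw [this, v.map_mul]
  · exact V.ratio_ne_zero hh (by simpa using ha0)
  · exact V.ratio_ne_zero hh (by simpa using hb0)

theorem value_smul {k : ℕ} {a : V.coordRing} (ha : a ∈ V.piece k) (ha0 : a ≠ 0) {c : ℂ}
    (hc : c ≠ 0) : V.value v h k (c • a) = V.value v h k a := by
  rw [value_of_mem v h ha, value_of_mem v h (Submodule.smul_mem _ c ha)]
  have := V.ratio_smul h c ⟨a, ha⟩
  rw [← v.map_smul c _ hc (V.ratio_ne_zero hh (a := ⟨a, ha⟩) (by simpa using ha0)), ← this]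
  rfl

theorem min_le_value_add {k : ℕ} {a b : V.coordRing} (ha : a ∈ V.piece k) (hb : b ∈ V.piece k)
    (ha0 : a ≠ 0) (hb0 : b ≠ 0) (hab : a + b ≠ 0) :
    min (toLex (V.value v h k a)) (toLex (V.value v h k b)) ≤
      toLex (V.value v h k (a + b)) := by
  rw [value_of_mem v h ha, value_of_mem v h hb, value_of_mem v h (add_mem ha hb)]
  have h1 := V.ratio_add h ⟨a, ha⟩ ⟨b, hb⟩
  have h2 : V.ratio h (⟨a + b, add_mem ha hb⟩ : V.piece k) ≠ 0 :=
    V.ratio_ne_zero hh (by simpa using hab)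
  have h3 : (⟨a + b, add_mem ha hb⟩ : V.piece k) = ⟨a, ha⟩ + ⟨b, hb⟩ := rfl
  rw [h3] at h2 ⊢
  rw [h1] at h2 ⊢
  exact v.map_add _ _ (V.ratio_ne_zero hh (by simpa using ha0))
    (V.ratio_ne_zero hh (by simpa using hb0)) h2

theorem value_one : V.value v h 0 1 = 0 := by
  have := value_mul v hh V.one_mem_piece V.one_mem_piece one_ne_zero one_ne_zero
  simpa using this

/-- Division by `h ^ k` is linear and injective on `R_k`, so the leaf condition on the function
field transfers to `R_k`. Every later use of one-dimensional leaves passes through this lemma. -/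
theorem exists_sub_smul (hv : v.HasOneDimLeaves) {k : ℕ} {a b : V.coordRing}
    (ha : a ∈ V.piece k) (hb : b ∈ V.piece k) (ha0 : a ≠ 0) (hb0 : b ≠ 0)
    (hab : V.value v h k a = V.value v h k b) :
    ∃ c : ℂ, c ≠ 0 ∧ (b - c • a = 0 ∨
      toLex (V.value v h k b) < toLex (V.value v h k (b - c • a))) := by
  have hr : ∀ c : ℂ, V.ratio h (⟨b - c • a, sub_mem hb (Submodule.smul_mem _ c ha)⟩ : V.piece k) =
      V.ratio h ⟨b, hb⟩ - c • V.ratio h ⟨a, ha⟩ := by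
    intro c
    have h1 := V.ratio_add h (⟨b, hb⟩ : V.piece k) ((-c) • ⟨a, ha⟩)
    rw [ratio_smul, neg_smul, ← sub_eq_add_neg] at h1
    rw [← h1]
    congr 1
    apply Subtype.ext
    simp [sub_eq_add_neg]
  rw [value_of_mem v h ha, value_of_mem v h hb] at hab
  obtain ⟨c, hc, hc'⟩ := hv _ _ (V.ratio_ne_zero hh (a := ⟨a, ha⟩) (by simpa using ha0))
    (V.ratio_ne_zero hh (a := ⟨b, hb⟩) (by simpa using hb0)) hab
  refine ⟨c, hc, ?_⟩
  rw [← hr] at hc'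
  rw [value_of_mem v h hb, value_of_mem v h (sub_mem hb (Submodule.smul_mem _ c ha))]
  refine hc'.imp_left fun h0 => ?_
  by_contra h1
  exact V.ratio_ne_zero hh (by simpa using h1) h0

/-- The elements of `R_k` that vanish or have value larger than `u`. -/
def above (k : ℕ) (u : Fin n → ℤ) : Submodule ℂ V.coordRing where
  carrier := {a | a ∈ V.piece k ∧ (a = 0 ∨ toLex u < toLex (V.value v h k a))}
  zero_mem' := ⟨zero_mem _, Or.inl rfl⟩
  add_mem' := by
    rintro a b ⟨ha, ha'⟩ ⟨hb, hb'⟩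
    refine ⟨add_mem ha hb, ?_⟩
    by_cases ha0 : a = 0
    · simpa [ha0] using hb'
    by_cases hb0 : b = 0
    · simpa [hb0] using ha'
    by_cases hab : a + b = 0
    · exact Or.inl hab
    · exact Or.inr (lt_of_lt_of_le (lt_min (ha'.resolve_left ha0) (hb'.resolve_left hb0))
        (min_le_value_add v hh ha hb ha0 hb0 hab))
  smul_mem' := by
    rintro c a ⟨ha, ha'⟩
    refine ⟨Submodule.smul_mem _ c ha, ?_⟩
    by_cases hc : c = 0
    · simp [hc]
    by_cases ha0 : a = 0
    · simp [ha0]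
    · exact Or.inr (by rw [value_smul v hh ha ha0 hc]; exact ha'.resolve_left ha0)

theorem mem_above {k : ℕ} {u : Fin n → ℤ} {a : V.coordRing} :
    a ∈ above v hh k u ↔ a ∈ V.piece k ∧ (a = 0 ∨ toLex u < toLex (V.value v h k a)) := Iff.rfl

omit hh in
/-- The sum of the graded pieces is direct. -/
theorem sum_piece_eq_zero {ι : Type*} (s : Finset ι) (m : ι → ℕ) (b : ι → V.coordRing)
    (hb : ∀ i, b i ∈ V.piece (m i)) (h0 : ∑ i ∈ s, b i = 0) (k : ℕ) :
    ∑ i ∈ s with m i = k, b i = 0 := by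
  -- Lift to homogeneous polynomials. Their sum lies in the homogeneous ideal of `V`, hence so does
  -- its component of degree `k`, which collects exactly the lifts of that degree.
  choose F hF hFb using hb
  have h1 : ∑ i ∈ s, F i ∈ V.ideal := by
    rw [← Ideal.Quotient.eq_zero_iff_mem, map_sum, ← h0]
    exact Finset.sum_congr rfl fun i _ => hFb i
  have h2 := V.isHomogeneous _ h1 k
  rw [map_sum] at h2
  have h3 : ∑ i ∈ s, homogeneousComponent k (F i) = ∑ i ∈ s with m i = k, F i := by
    rw [Finset.sum_filter]
    refine Finset.sum_congr rfl fun i _ => ?_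
    rw [homogeneousComponent_of_mem (hF i)]
    simp only [eq_comm]
  rw [h3, ← Ideal.Quotient.eq_zero_iff_mem, map_sum] at h2
  rw [← h2]
  exact Finset.sum_congr rfl fun i _ => (hFb i).symm

/-- Homogeneous elements with pairwise distinct degrees and values are linearly independent. -/
theorem linearIndependent_of_value {ι : Type*} (m : ι → ℕ) (b : ι → V.coordRing)
    (hb : ∀ i, b i ∈ V.piece (m i)) (hb0 : ∀ i, b i ≠ 0)
    (hinj : Function.Injective fun i => (m i, V.value v h (m i) (b i))) :
    LinearIndependent ℂ b := by
  classical
  rw [linearIndependent_iff']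
  intro s c hsum i hi
  by_contra hci
  have h1 := sum_piece_eq_zero s m (fun i => c i • b i)
    (fun i => Submodule.smul_mem _ _ (hb i)) hsum (m i)
  set t := s.filter fun j => m j = m i ∧ c j ≠ 0 with ht
  have h2 : ∑ j ∈ t, c j • b j = 0 := by
    rw [← h1, ht, ← Finset.filter_filter]
    refine Finset.sum_filter_of_ne fun j _ hj => ?_
    rintro h0
    simp [h0] at hj
  -- The term of least value cannot be cancelled: all others have strictly larger value, so the
  -- relation would give `b j` a value larger than its own.
  obtain ⟨j, hj, hmin⟩ := t.exists_min_image (fun j => toLex (V.value v h (m i) (b j)))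
    ⟨i, by simp [ht, hi, hci]⟩
  have hjt : j ∈ s ∧ m j = m i ∧ c j ≠ 0 := by simpa [ht] using hj
  have h3 : ∑ l ∈ t.erase j, c l • b l ∈ above v hh (m i) (V.value v h (m i) (b j)) := by
    refine Submodule.sum_mem _ fun l hl => Submodule.smul_mem _ _ ?_
    obtain ⟨hlj, hlt⟩ := Finset.mem_erase.1 hl
    have hml : l ∈ s ∧ m l = m i ∧ c l ≠ 0 := by simpa [ht] using hlt
    refine ⟨hml.2.1 ▸ hb l, Or.inr (lt_of_le_of_ne (hmin l hlt) fun heq => hlj (hinj ?_))⟩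
    have := toLex.injective heq
    simp only [Prod.mk.injEq, hml.2.1, hjt.2.1, true_and]
    exact this.symm
  rw [← Finset.add_sum_erase _ _ hj] at h2
  have h4 : c j • b j ∈ above v hh (m i) (V.value v h (m i) (b j)) := by
    rw [eq_neg_of_add_eq_zero_left h2]; exact neg_mem h3
  have h5 : b j ∈ above v hh (m i) (V.value v h (m i) (b j)) := by
    have := Submodule.smul_mem _ (c j)⁻¹ h4
    rwa [smul_smul, inv_mul_cancel₀ hjt.2.2, one_smul] at this
  exact (h5.2.resolve_left (hb0 j)).false

omit hh in
variable (V) in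
instance finite_piece (k : ℕ) : Module.Finite ℂ (V.piece k) := by
  have : Module.Finite ℂ (homogeneousSubmodule (Fin (N + 1)) ℂ k) :=
    Module.Finite.iff_fg.2 (homogeneousSubmodule_fg _ _ k)
  unfold piece
  infer_instance

/-- The values that occur on `R_k`. -/
theorem finite_values (k : ℕ) :
    {u | ∃ a ∈ V.piece k, a ≠ 0 ∧ V.value v h k a = u}.Finite := by
  set U := {u | ∃ a ∈ V.piece k, a ≠ 0 ∧ V.value v h k a = u} with hU
  -- One witness per value gives an independent family in the finite-dimensional space `R_k`.
  choose b hb hb0 hbv using fun u : U => u.2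
  have h1 : LinearIndependent ℂ b := linearIndependent_of_value v hh (fun _ => k) b hb hb0 (by
    intro u w huw
    simp only [Prod.mk.injEq, true_and, hbv] at huw
    exact Subtype.ext huw)
  have h2 : LinearIndependent ℂ fun u : U => (⟨b u, hb u⟩ : V.piece k) :=
    LinearIndependent.of_comp (V.piece k).subtype h1
  exact h2.finite

/-- Subduction: if every value of `P ≤ R_k` is a value of `P ⊓ W`, then `P ≤ W`. -/
theorem le_of_forall_exists_value (hv : v.HasOneDimLeaves) {k : ℕ}
    {P W : Submodule ℂ V.coordRing} (hP : P ≤ V.piece k)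
    (hPW : ∀ a ∈ P, a ≠ 0 → ∃ b ∈ P, b ∈ W ∧ b ≠ 0 ∧ V.value v h k b = V.value v h k a) :
    P ≤ W := by
  by_contra hnot
  obtain ⟨a₀, ha₀, ha₀W⟩ := SetLike.not_le_iff_exists.1 hnot
  set U := {u | ∃ a ∈ P, a ∉ W ∧ toLex (V.value v h k a) = u} with hU
  have hfin : U.Finite := by
    refine ((finite_values v hh k).image toLex).subset ?_
    rintro _ ⟨a, ha, haW, rfl⟩
    exact ⟨_, ⟨a, hP ha, fun h0 => haW (h0 ▸ zero_mem _), rfl⟩, rfl⟩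
  -- Among the elements of `P` outside `W` choose one of maximal value. Subtracting a multiple of an
  -- element of `P ⊓ W` with the same value stays outside `W` and raises the value, a contradiction.
  obtain ⟨u, ⟨a, ha, haW, hau⟩, hmax⟩ := hfin.exists_maximal ⟨_, a₀, ha₀, ha₀W, rfl⟩
  have ha0 : a ≠ 0 := fun h0 => haW (h0 ▸ zero_mem _)
  obtain ⟨b, hbP, hbW, hb0, hba⟩ := hPW a ha ha0
  obtain ⟨c, hc, hc'⟩ := exists_sub_smul v hh hv (hP hbP) (hP ha) hb0 ha0 hba
  have hsub : a - c • b ∉ W := fun hmem => haW (by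
    simpa using add_mem hmem (Submodule.smul_mem _ c hbW))
  rcases hc' with h0 | hlt
  · exact hsub (h0 ▸ zero_mem _)
  · rw [hau] at hlt
    exact absurd (hmax ⟨_, sub_mem ha (Submodule.smul_mem _ c hbP), hsub, rfl⟩ hlt.le)
      (not_le_of_gt hlt)

end ProjectiveVariety

/-! ### Existence of SAGBI bases -/

namespace ProjectiveVariety

variable {N n : ℕ} {V : ProjectiveVariety N} (v : LatticeValuation n V.functionField)
  {h : V.piece 1} (hh : h ≠ 0)

theorem gradedValue_eq (h : V.piece 1) {k : ℕ} (a : V.piece k) :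
    V.gradedValue v h a = ((k : ℤ), V.value v h k a) := by
  rw [gradedValue, value_coe]

theorem mem_valueSemigroup {h : V.piece 1} {k : ℕ} (hk : 0 < k) {a : V.coordRing}
    (ha : a ∈ V.piece k) (ha0 : a ≠ 0) : ((k : ℤ), V.value v h k a) ∈ V.valueSemigroup v h :=
  ⟨k, hk, ⟨a, ha⟩, by simpa using ha0, (gradedValue_eq v h ⟨a, ha⟩).symm⟩

include hh

/-- The value semigroup as a subsemigroup. -/
def valueAddSubsemigroup : AddSubsemigroup (ℤ × (Fin n → ℤ)) where
  carrier := V.valueSemigroup v h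
  add_mem' := by
    rintro _ _ ⟨k, hk, a, ha, rfl⟩ ⟨l, _, b, hb, rfl⟩
    have ha' : (a : V.coordRing) ≠ 0 := by simpa using ha
    have hb' : (b : V.coordRing) ≠ 0 := by simpa using hb
    have := mem_valueSemigroup v (h := h) (k := k + l) (by omega) (V.mul_mem_piece a.2 b.2)
      (mul_ne_zero ha' hb')
    rw [value_mul v hh a.2 b.2 ha' hb'] at this
    rw [gradedValue_eq, gradedValue_eq]
    simpa using this

/-- Each `R_k` has a basis that attains all values of nonzero elements of `R_k`. -/
theorem exists_basis_value (hv : v.HasOneDimLeaves) (k : ℕ) :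
    ∃ (d : ℕ) (b : Module.Basis (Fin d) ℂ (V.piece k)),
      ∀ a ∈ V.piece k, a ≠ 0 → ∃ j, V.value v h k (b j) = V.value v h k a := by
  set U := {u | ∃ a ∈ V.piece k, a ≠ 0 ∧ V.value v h k a = u} with hU
  have : Finite U := finite_values v hh k
  obtain ⟨d, ⟨e⟩⟩ := Finite.exists_equiv_fin U
  choose b hb hb0 hbv using fun u : U => u.2
  have h1 : LinearIndependent ℂ b := linearIndependent_of_value v hh (fun _ => k) b hb hb0 (by
    intro u w huw
    simp only [Prod.mk.injEq, true_and, hbv] at huw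
    exact Subtype.ext huw)
  have h2 : LinearIndependent ℂ fun j : Fin d => (⟨b (e.symm j), hb _⟩ : V.piece k) :=
    LinearIndependent.of_comp (V.piece k).subtype (h1.comp _ e.symm.injective)
  -- Subduction with `P = R_k`: the span of the witnesses attains every value, so it is all of
  -- `R_k`.
  have h3 : V.piece k ≤ (Submodule.span ℂ
      (Set.range fun j : Fin d => (⟨b (e.symm j), hb _⟩ : V.piece k))).map
        (V.piece k).subtype := by
    refine le_of_forall_exists_value v hh hv le_rfl fun a ha ha0 => ?_
    let u : U := ⟨V.value v h k a, a, ha, ha0, rfl⟩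
    exact ⟨b u, hb u, ⟨⟨b u, hb u⟩, Submodule.subset_span ⟨e u, by simp⟩, rfl⟩, hb0 u, hbv u⟩
  refine ⟨d, Module.Basis.mk h2 fun a _ => ?_, fun a ha ha0 => ?_⟩
  · obtain ⟨a', ha', haa⟩ := h3 a.2
    rwa [← Subtype.ext haa]
  · refine ⟨e ⟨V.value v h k a, a, ha, ha0, rfl⟩, ?_⟩
    rw [Module.Basis.mk_apply]
    simp only [Equiv.symm_apply_apply]
    exact hbv _

theorem nonempty_sagbiBasis (hv : v.HasOneDimLeaves) (hS : V.FinitelyGeneratedValues v h) :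
    Nonempty (SagbiBasis V v h) := by
  obtain ⟨T, hT⟩ := hS
  choose d b hb using exists_basis_value v hh hv
  -- Bases are needed up to the largest degree of a generator of `S`. The index `i` stands for
  -- degree `i + 1`, and the extra `+ 1` makes `r` positive without further argument.
  refine ⟨⟨T.sup (fun s => s.1.toNat) + 1, Nat.succ_pos _, fun i => d (i + 1),
    fun i => b (i + 1), ?_⟩⟩
  apply Set.Subset.antisymm
  · show _ ⊆ (valueAddSubsemigroup v hh : Set (ℤ × (Fin n → ℤ)))
    rw [SetLike.coe_subset_coe, AddSubsemigroup.closure_le]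
    rintro _ ⟨⟨i, j⟩, rfl⟩
    exact ⟨i + 1, Nat.succ_pos _, b (i + 1) j, (b (i + 1)).ne_zero j, rfl⟩
  · rw [← hT, SetLike.coe_subset_coe, AddSubsemigroup.closure_le]
    intro s hs
    have hsS : s ∈ V.valueSemigroup v h := hT ▸ AddSubsemigroup.subset_closure hs
    obtain ⟨k, hk, a, ha, rfl⟩ := hsS
    obtain ⟨i, rfl⟩ : ∃ i, k = i + 1 := ⟨k - 1, by omega⟩
    have hle := Finset.le_sup (f := fun s : ℤ × (Fin n → ℤ) => s.1.toNat) hs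
    have hi : i < T.sup (fun s => s.1.toNat) + 1 := by
      have : (V.gradedValue v h a).1.toNat = i + 1 := by simp [gradedValue]
      simp only [this] at hle
      omega
    obtain ⟨j, hj⟩ := hb (i + 1) a a.2 (by simpa using ha)
    refine AddSubsemigroup.subset_closure ⟨⟨⟨i, hi⟩, j⟩, ?_⟩
    simp only [gradedValue_eq, hj]

end ProjectiveVariety

namespace SagbiBasis

open ProjectiveVariety

variable {N n : ℕ} {V : ProjectiveVariety N} {v : LatticeValuation n V.functionField}
  {h : V.piece 1} (B : SagbiBasis V v h)

/-! ### Monomials in the elements of a SAGBI basis -/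

theorem weight_degree_fst (α : B.Index →₀ ℕ) :
    (Finsupp.weight B.degree α).1 = (Finsupp.weight B.weight α : ℤ) := by
  induction α using Finsupp.induction_linear with
  | zero => simp
  | add α β hα hβ => simp [hα, hβ]
  | single i k => simp [Finsupp.weight_apply, degree, weight, gradedValue]

theorem eq_zero_of_weight_eq_zero {α : B.Index →₀ ℕ} (hα : Finsupp.weight B.weight α = 0) :
    α = 0 := by
  have : Finsupp.NonTorsionWeight ℕ B.weight :=
    Finsupp.nonTorsionWeight_of ℕ B.weight fun i => by simp [weight]
  exact (Finsupp.weight_eq_zero_iff_eq_zero B.weight).1 hα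

theorem elt_ne_zero (i : B.Index) : B.elt i ≠ 0 := by
  simpa [elt] using (B.basis i.1).ne_zero i.2

theorem elt_mem (i : B.Index) : B.elt i ∈ V.piece (B.weight i) := (B.basis i.1 i.2).2

theorem degree_eq (i : B.Index) :
    B.degree i = ((B.weight i : ℤ), V.value v h (B.weight i) (B.elt i)) :=
  gradedValue_eq v h _

/-- The monomial `x ^ α` evaluated at the `f_{ij}`. -/
def monomialValue (α : B.Index →₀ ℕ) : V.coordRing := aeval B.elt (monomial α (1 : ℂ))

theorem monomialValue_add (α β : B.Index →₀ ℕ) :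
    B.monomialValue (α + β) = B.monomialValue α * B.monomialValue β := by
  rw [monomialValue, monomialValue, monomialValue, ← map_mul, monomial_mul, one_mul]

theorem monomialValue_single_one (i : B.Index) :
    B.monomialValue (Finsupp.single i 1) = B.elt i := by
  rw [monomialValue, ← X, aeval_X]

theorem aeval_monomial_elt (α : B.Index →₀ ℕ) (c : ℂ) :
    aeval B.elt (monomial α c) = c • B.monomialValue α := by
  rw [monomialValue, ← map_smul, smul_monomial, smul_eq_mul, mul_one]

theorem aeval_elt (F : MvPolynomial B.Index ℂ) :
    aeval B.elt F = ∑ α ∈ F.support, F.coeff α • B.monomialValue α := by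
  conv_lhs => rw [F.as_sum]
  simp only [map_sum, aeval_monomial_elt]

section NeZero

variable (hh : h ≠ 0)
include hh

/-- Multiplicativity of `v` identifies the formal degree of `x ^ α` with the actual degree and value
of `f ^ α`. The three claims are proved together, since adding values requires both factors to be
homogeneous and nonzero. -/
theorem monomialValue_spec (α : B.Index →₀ ℕ) :
    B.monomialValue α ∈ V.piece (Finsupp.weight B.weight α) ∧ B.monomialValue α ≠ 0 ∧
      Finsupp.weight B.degree α = ((Finsupp.weight B.weight α : ℤ),
        V.value v h (Finsupp.weight B.weight α) (B.monomialValue α)) := by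
  have hzero : B.monomialValue 0 = 1 := by simp [monomialValue]
  induction α using Finsupp.induction_linear with
  | zero =>
    rw [hzero]
    simp only [map_zero]
    exact ⟨V.one_mem_piece, one_ne_zero, by rw [value_one v hh]; rfl⟩
  | add α β hα hβ =>
    obtain ⟨hα, hα0, hα'⟩ := hα
    obtain ⟨hβ, hβ0, hβ'⟩ := hβ
    rw [monomialValue_add, map_add, map_add, value_mul v hh hα hβ hα0 hβ0]
    refine ⟨V.mul_mem_piece hα hβ, mul_ne_zero hα0 hβ0, ?_⟩
    rw [hα', hβ']
    simp
  | single i k =>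
    induction k with
    | zero =>
      simp only [Finsupp.single_zero, hzero, map_zero]
      exact ⟨V.one_mem_piece, one_ne_zero, by rw [value_one v hh]; rfl⟩
    | succ k ih =>
      obtain ⟨hα, hα0, hα'⟩ := ih
      have h1 := B.elt_mem i
      have h2 := B.elt_ne_zero i
      have hw : Finsupp.weight B.weight (Finsupp.single i 1) = B.weight i := by
        simp [Finsupp.weight_apply]
      have hd : Finsupp.weight B.degree (Finsupp.single i 1) = B.degree i := by
        simp [Finsupp.weight_apply]
      rw [Finsupp.single_add, monomialValue_add, map_add, map_add, monomialValue_single_one, hw,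
        hd, value_mul v hh hα h1 hα0 h2]
      refine ⟨V.mul_mem_piece hα h1, mul_ne_zero hα0 h2, ?_⟩
      rw [hα', degree_eq]
      simp

theorem monomialValue_mem (α : B.Index →₀ ℕ) :
    B.monomialValue α ∈ V.piece (Finsupp.weight B.weight α) := (B.monomialValue_spec hh α).1

theorem monomialValue_ne_zero (α : B.Index →₀ ℕ) : B.monomialValue α ≠ 0 :=
  (B.monomialValue_spec hh α).2.1

theorem weight_degree_eq (α : B.Index →₀ ℕ) :
    Finsupp.weight B.degree α = ((Finsupp.weight B.weight α : ℤ),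
      V.value v h (Finsupp.weight B.weight α) (B.monomialValue α)) :=
  (B.monomialValue_spec hh α).2.2

theorem weight_degree_eq_iff {α : B.Index →₀ ℕ} {m : ℕ} {u : Fin n → ℤ} :
    Finsupp.weight B.degree α = ((m : ℤ), u) ↔
      Finsupp.weight B.weight α = m ∧ V.value v h m (B.monomialValue α) = u := by
  rw [weight_degree_eq B hh, Prod.mk.injEq, Nat.cast_inj]
  constructor <;> · rintro ⟨rfl, h2⟩; exact ⟨rfl, h2⟩

/-- Every value is attained by a monomial in the SAGBI basis. -/
theorem exists_monomialValue {m : ℕ} {a : V.coordRing} (ha : a ∈ V.piece m) (ha0 : a ≠ 0) :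
    ∃ α : B.Index →₀ ℕ, Finsupp.weight B.degree α = ((m : ℤ), V.value v h m a) := by
  -- Degree zero is not covered by `S`, but `R_0` consists of constants, of value zero, so the empty
  -- monomial serves.
  rcases Nat.eq_zero_or_pos m with rfl | hm
  · obtain ⟨F, hF, rfl⟩ := ha
    have hF' : F.totalDegree = 0 := (totalDegree_zero_iff_isHomogeneous _).2 hF
    rw [totalDegree_eq_zero_iff_eq_C] at hF'
    have hc : coeff 0 F ≠ 0 := by
      intro hc
      rw [hc, C_0] at hF'
      exact ha0 (by rw [hF', map_zero])
    have h1 : (Ideal.Quotient.mkₐ ℂ V.ideal).toLinearMap F = coeff 0 F • (1 : V.coordRing) := by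
      conv_lhs => rw [hF']
      rw [← mul_one (C _), ← smul_eq_C_mul, map_smul]
      simp
    refine ⟨0, ?_⟩
    rw [h1, value_smul v hh V.one_mem_piece one_ne_zero hc, value_one v hh]
    rfl
  · have h1 := mem_valueSemigroup v (h := h) hm ha ha0
    rw [← B.closure_eq] at h1
    generalize ((m : ℤ), V.value v h m a) = s at h1 ⊢
    induction h1 using AddSubsemigroup.closure_induction with
    | mem s hs =>
      obtain ⟨i, rfl⟩ := hs
      exact ⟨Finsupp.single i 1, by simp [Finsupp.weight_apply, degree]⟩
    | add s t _ _ hs ht =>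
      obtain ⟨α, rfl⟩ := hs
      obtain ⟨β, rfl⟩ := ht
      exact ⟨α + β, map_add _ _ _⟩

/-! ### Existence of relations -/

/-- An element of `R_m` of value larger than `u` is a polynomial in the SAGBI basis all of whose
monomials have degree lower than `(m, u)`. -/
theorem exists_aeval_eq_of_mem_above (hv : v.HasOneDimLeaves) {m : ℕ} {u : Fin n → ℤ}
    {a : V.coordRing} (ha : a ∈ above v hh m u) :
    ∃ G : MvPolynomial B.Index ℂ, aeval B.elt G = a ∧ IsWeightedHomogeneous B.weight G m ∧
      ∀ α ∈ G.support, degreeLT (Finsupp.weight B.degree α) ((m : ℤ), u) := by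
  -- Subduction again, with `W` the image of the polynomials supported on the allowed monomials. A
  -- single monomial already attains each required value.
  have hle : above v hh m u ≤ (restrictSupport ℂ {α : B.Index →₀ ℕ |
      Finsupp.weight B.weight α = m ∧ degreeLT (Finsupp.weight B.degree α) ((m : ℤ), u)}).map
        (aeval B.elt).toLinearMap := by
    refine le_of_forall_exists_value v hh hv (fun a ha => ha.1) fun a ha ha0 => ?_
    obtain ⟨α, hα⟩ := B.exists_monomialValue hh ha.1 ha0
    have hα' := (B.weight_degree_eq_iff hh).1 hα
    have hlt := ha.2.resolve_left ha0
    refine ⟨B.monomialValue α, ⟨hα'.1 ▸ B.monomialValue_mem hh α, Or.inr (by rwa [hα'.2])⟩,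
      ⟨monomial α 1, ?_, rfl⟩, B.monomialValue_ne_zero hh α, hα'.2⟩
    rw [SetLike.mem_coe, mem_restrictSupport_iff]
    intro β hβ
    have hβα : β = α := by
      have := support_monomial_subset hβ
      simpa using this
    subst hβα
    exact ⟨hα'.1, by rw [hα]; exact Or.inr ⟨rfl, hlt⟩⟩
  obtain ⟨G, hG, hGa⟩ := hle ha
  rw [SetLike.mem_coe, mem_restrictSupport_iff] at hG
  exact ⟨G, hGa, fun α hα => (hG (mem_support_iff.2 hα)).1, fun α hα => (hG hα).2⟩

theorem isWeightedHomogeneous_weight {F : MvPolynomial B.Index ℂ} {m : ℕ} {u : Fin n → ℤ}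
    (hF : IsWeightedHomogeneous B.degree F ((m : ℤ), u)) : IsWeightedHomogeneous B.weight F m :=
  fun _ hα => ((B.weight_degree_eq_iff hh).1 (hF hα)).1

theorem initialIdeal_generator_iff {F : MvPolynomial B.Index ℂ} {m : ℕ} {u : Fin n → ℤ} :
    (∃ a : V.piece m, aeval B.elt F = (a : V.coordRing) ∧
      (a = 0 ∨ toLex u < toLex (v.toFun (V.ratio h a)))) ↔
      aeval B.elt F ∈ above v hh m u := by
  rw [mem_above]
  constructor
  · rintro ⟨a, ha, ha'⟩
    rw [ha]
    exact ⟨a.2, by simpa [value_coe] using ha'⟩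
  · rintro ⟨ha, ha'⟩
    refine ⟨⟨_, ha⟩, rfl, ?_⟩
    rw [value_of_mem v h ha] at ha'
    simpa using ha'

/-- A homogeneous generator `F` of the initial ideal evaluates to something of larger value than its
degree predicts. That element is also `G(f)` with `G` of lower terms, so `F - G` is a relation with
leading part `F`. -/
theorem nonempty_relations (hv : v.HasOneDimLeaves) : Nonempty B.Relations := by
  classical
  -- The finite generating set is extracted from the defining generators, so its members are already
  -- homogeneous; zero is then discarded.
  obtain ⟨t, htS, htspan⟩ := (Submodule.fg_span_iff_fg_span_finset_subset _).1
    (IsNoetherian.noetherian B.initialIdeal)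
  set s := t.erase 0 with hs
  have hspan : Ideal.span (s : Set (MvPolynomial B.Index ℂ)) = B.initialIdeal := by
    refine Eq.trans ?_ htspan.symm
    rw [hs, Finset.coe_erase]
    exact Submodule.span_sdiff_singleton_zero
  have key : ∀ F : s, ∃ (d : ℤ × (Fin n → ℤ)) (g : MvPolynomial B.Index ℂ),
      IsWeightedHomogeneous B.degree (F : MvPolynomial B.Index ℂ) d ∧ aeval B.elt g = 0 ∧
      (∃ k, IsWeightedHomogeneous B.weight g k) ∧
      ∀ α ∈ (g - F).support, degreeLT (Finsupp.weight B.degree α) d := by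
    rintro ⟨F, hF⟩
    obtain ⟨m, u, hFh, hFa⟩ := htS (Finset.mem_of_mem_erase hF)
    rw [B.initialIdeal_generator_iff hh] at hFa
    obtain ⟨G, hGa, hGw, hGl⟩ := B.exists_aeval_eq_of_mem_above hh hv hFa
    refine ⟨_, F - G, hFh, by rw [map_sub, hGa, sub_self],
      ⟨m, (weightedHomogeneousSubmodule ℂ B.weight m).sub_mem
        (B.isWeightedHomogeneous_weight hh hFh) hGw⟩, ?_⟩
    simpa using hGl
  choose d g hd hg hgw hgl using key
  refine ⟨⟨s.card, fun k => d (s.equivFin.symm k), fun k => s.equivFin.symm k, fun k => ?_,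
    fun k => hd _, ?_, fun k => g (s.equivFin.symm k), fun k => hg _, fun k => hgw _,
    fun k => hgl _⟩⟩
  · exact Finset.ne_of_mem_erase (s.equivFin.symm k).2
  · rw [← hspan]
    congr 1
    ext F
    constructor
    · rintro ⟨k, rfl⟩
      exact (s.equivFin.symm k).2
    · intro hF
      exact ⟨s.equivFin ⟨F, hF⟩, by simp⟩

end NeZero

end SagbiBasis

/-! ### Order preserving projections -/

/-- On finitely many vectors the lexicographic order is given by a linear form whose coefficients
decrease fast enough. The induction is on the number `k` of last coordinates allowed to be nonzero.
-/
theorem exists_linearMap_pos_of_lex {n : ℕ} (P : Finset (Fin n → ℤ))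
    (hP : ∀ d ∈ P, toLex 0 < toLex d) :
    ∃ q : (Fin n → ℤ) →ₗ[ℤ] ℤ, ∀ d ∈ P, 0 < q d := by
  have key : ∀ k ≤ n, ∃ q : (Fin n → ℤ) →ₗ[ℤ] ℤ,
      ∀ d ∈ P, (∀ j : Fin n, (j : ℕ) + k < n → d j = 0) → 0 < q d := by
    intro k
    induction k with
    | zero =>
      intro _
      refine ⟨0, fun d hd h0 => ?_⟩
      have hd0 : d = 0 := funext fun j => h0 j (by simp)
      exact absurd (hP d hd) (by rw [hd0]; exact lt_irrefl _)
    | succ k ih =>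
      intro hk
      obtain ⟨q, hq⟩ := ih (by omega)
      let i : Fin n := ⟨n - k - 1, by omega⟩
      -- The new coefficient exceeds every `|q d|`, so a leading entry of at least 1 outweighs all
      -- later coordinates.
      refine ⟨(∑ d ∈ P, |q d| + 1) • LinearMap.proj i + q, fun d hd h0 => ?_⟩
      have hqd : |q d| ≤ ∑ d ∈ P, |q d| :=
        Finset.single_le_sum (f := fun d => |q d|) (fun _ _ => abs_nonneg _) hd
      have habs := neg_abs_le (q d)
      simp only [LinearMap.add_apply, LinearMap.smul_apply, LinearMap.proj_apply, smul_eq_mul]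
      by_cases hi : d i = 0
      · rw [hi, mul_zero, zero_add]
        refine hq d hd fun j hj => ?_
        by_cases hji : j = i
        · rw [hji, hi]
        · refine h0 j ?_
          have : (j : ℕ) ≠ n - k - 1 := fun h => hji (Fin.ext h)
          omega
      · obtain ⟨l, hl, hlpos⟩ := hP d hd
        have hli : l = i := by
          rcases lt_trichotomy l i with h | h | h
          · have hlt : (l : ℕ) < n - k - 1 := h
            have : d l = 0 := h0 l (by omega)
            exact absurd hlpos (by simp [this])
          · exact h
          · exact absurd (hl i h).symm hi
        rw [hli] at hlpos
        have h1 : 1 ≤ d i := hlpos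
        have h2 := le_mul_of_one_le_right
          (add_nonneg ((abs_nonneg _).trans hqd) (zero_le_one' ℤ)) h1
        linarith
  obtain ⟨q, hq⟩ := key n le_rfl
  exact ⟨q, fun d hd => hq d hd fun j hj => absurd hj (by omega)⟩

/-- The degree gets a coefficient dominating the second component. The form `q` enters with a minus
sign because `degreeLT` reverses the lexicographic order; its positivity is needed only where the
degree is zero. -/
theorem exists_linearMap_pos {n : ℕ} (E : Finset (ℤ × (Fin n → ℤ)))
    (hE : ∀ e ∈ E, degreeLT 0 e) :
    ∃ p : (ℤ × (Fin n → ℤ)) →ₗ[ℤ] ℤ, ∀ e ∈ E, 0 < p e := by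
  classical
  obtain ⟨q, hq⟩ := exists_linearMap_pos_of_lex
    ((E.image fun e => -e.2).filter fun d => toLex 0 < toLex d)
    (fun d hd => (Finset.mem_filter.1 hd).2)
  refine ⟨(∑ e ∈ E, |q e.2| + 1) • LinearMap.fst ℤ ℤ _ - q ∘ₗ LinearMap.snd ℤ ℤ _,
    fun e he => ?_⟩
  have hqe : |q e.2| ≤ ∑ e ∈ E, |q e.2| :=
    Finset.single_le_sum (f := fun e : ℤ × (Fin n → ℤ) => |q e.2|) (fun _ _ => abs_nonneg _) he
  have habs := le_abs_self (q e.2)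
  simp only [LinearMap.sub_apply, LinearMap.smul_apply, LinearMap.fst_apply, smul_eq_mul,
    LinearMap.comp_apply, LinearMap.snd_apply]
  rcases hE e he with h1 | ⟨h1, h2⟩
  · have h2 := le_mul_of_one_le_right
      (add_nonneg ((abs_nonneg _).trans hqe) (zero_le_one' ℤ)) (show 1 ≤ e.1 from h1)
    linarith
  · have h3 : toLex 0 < toLex (-e.2) := by
      obtain ⟨i, hi, hlt⟩ := h2
      refine ⟨i, fun j hj => ?_, ?_⟩
      · have := hi j hj
        simp only [Pi.toLex_apply, Prod.snd_zero, Pi.zero_apply, Pi.neg_apply] at this ⊢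
        omega
      · simp only [Pi.toLex_apply, Prod.snd_zero, Pi.zero_apply, Pi.neg_apply] at hlt ⊢
        omega
    have h4 := hq (-e.2) (Finset.mem_filter.2 ⟨Finset.mem_image_of_mem _ he, h3⟩)
    rw [map_neg] at h4
    have h5 : e.1 = 0 := h1.symm
    rw [h5]
    linarith

theorem degreeLT.zero_sub {n : ℕ} {a b : ℤ × (Fin n → ℤ)} (hab : degreeLT a b) :
    degreeLT 0 (b - a) := by
  rcases hab with h1 | ⟨h1, i, hi, hlt⟩
  · left
    simpa using h1
  · refine Or.inr ⟨by simp [h1], i, fun j hj => ?_, ?_⟩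
    · have := hi j hj
      simp only [Pi.toLex_apply, Prod.snd_zero, Pi.zero_apply, Pi.sub_apply, Prod.snd_sub]
        at this ⊢
      omega
    · simp only [Pi.toLex_apply, Prod.snd_zero, Pi.zero_apply, Pi.sub_apply, Prod.snd_sub]
        at hlt ⊢
      omega

theorem degreeLT.ne {n : ℕ} {a b : ℤ × (Fin n → ℤ)} (hab : degreeLT a b) : a ≠ b := by
  rintro rfl
  rcases hab with h | ⟨_, h⟩ <;> exact lt_irrefl _ h

/-- By translation invariance, strict monotonicity on `T` amounts to positivity on the finitely many
positive differences. Elements of positive degree are adjoined to these. -/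
theorem exists_linearMap_strictMono {n : ℕ} (T : Finset (ℤ × (Fin n → ℤ))) :
    ∃ p : (ℤ × (Fin n → ℤ)) →ₗ[ℤ] ℤ, (∀ a ∈ T, ∀ b ∈ T, degreeLT a b → p a < p b) ∧
      ∀ a ∈ T, 0 < a.1 → 0 < p a := by
  classical
  obtain ⟨p, hp⟩ := exists_linearMap_pos
    ((((T ×ˢ T).image fun ab => ab.2 - ab.1) ∪ T).filter fun e => degreeLT 0 e)
    (fun e he => (Finset.mem_filter.1 he).2)
  refine ⟨p, fun a ha b hb hab => ?_, fun a ha ha1 => ?_⟩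
  · have := hp (b - a) (Finset.mem_filter.2 ⟨Finset.mem_union_left _ (Finset.mem_image.2
      ⟨(a, b), Finset.mem_product.2 ⟨ha, hb⟩, rfl⟩), hab.zero_sub⟩)
    rw [map_sub] at this
    linarith
  · exact hp a (Finset.mem_filter.2 ⟨Finset.mem_union_right _ ha, Or.inl ha1⟩)

/-! ### Weight projections adapted to a system of relations -/

namespace SagbiBasis.Relations

variable {N n : ℕ} {V : ProjectiveVariety N} {v : LatticeValuation n V.functionField}
  {h : V.piece 1} {B : SagbiBasis V v h} (D : B.Relations)

theorem mem_support_g_or {k : Fin D.q} {α : B.Index →₀ ℕ} (hα : α ∈ (D.g k).support) :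
    Finsupp.weight B.degree α = D.deg k ∨ degreeLT (Finsupp.weight B.degree α) (D.deg k) := by
  by_cases h0 : (D.gbar k).coeff α = 0
  · right
    refine D.g_lower k α ?_
    rw [mem_support_iff, coeff_sub, h0, sub_zero]
    exact mem_support_iff.1 hα
  · exact Or.inl (D.gbar_homogeneous k h0)

/-- A monomial of `gbar k` has degree exactly `deg k`, and `g k - gbar k` has only lower ones, so it
cannot cancel. Hence the monotonicity of `p` applies to comparisons with `deg k`. -/
theorem deg_mem (k : Fin D.q) : D.deg k ∈ D.monomialDegrees := by
  obtain ⟨α, hα⟩ := exists_coeff_ne_zero (D.gbar_ne_zero k)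
  have hd := D.gbar_homogeneous k hα
  refine ⟨k, α, ?_, hd.symm⟩
  by_contra h0
  refine (D.g_lower k α ?_).ne hd
  rw [notMem_support_iff] at h0
  rw [mem_support_iff, coeff_sub, h0, zero_sub]
  exact neg_ne_zero.2 hα

theorem weight_mem_of_mem_support_sub {k : Fin D.q} {α : B.Index →₀ ℕ}
    (hα : α ∈ (D.g k - D.gbar k).support) :
    Finsupp.weight B.degree α ∈ D.monomialDegrees := by
  refine ⟨k, α, ?_, rfl⟩
  have h0 : (D.gbar k).coeff α = 0 := by
    by_contra h0
    exact (D.g_lower k α hα).ne (D.gbar_homogeneous k h0)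
  rw [mem_support_iff, coeff_sub, h0, sub_zero] at hα
  exact mem_support_iff.2 hα

theorem finite_monomialDegrees : D.monomialDegrees.Finite := by
  refine (Set.finite_iUnion fun k : Fin D.q =>
    ((D.g k).support.finite_toSet.image (Finsupp.weight B.degree))).subset ?_
  rintro _ ⟨k, α, hα, rfl⟩
  exact Set.mem_iUnion.2 ⟨k, α, hα, rfl⟩

/-- There is a weight projection all of whose values are even, and positive on nonzero degrees. -/
theorem exists_even_weightProjection : ∃ p : (ℤ × (Fin n → ℤ)) →ₗ[ℤ] ℤ,
    D.IsWeightProjection p ∧ (∀ a ∈ D.monomialDegrees, a ≠ 0 → 1 < p a) ∧ ∀ a, Even (p a) := by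
  classical
  -- The degrees of the variables need not occur in the relations; they are added to force
  -- nonnegative weights.
  obtain ⟨p, hp, hp'⟩ := exists_linearMap_strictMono
    (D.finite_monomialDegrees.toFinset ∪ Finset.univ.image B.degree)
  have hmem : ∀ a ∈ D.monomialDegrees,
      a ∈ D.finite_monomialDegrees.toFinset ∪ Finset.univ.image B.degree := fun a ha =>
    Finset.mem_union_left _ (D.finite_monomialDegrees.mem_toFinset.2 ha)
  -- Doubling preserves the order, makes all values even and turns positive into greater than 1.
  refine ⟨(2 : ℤ) • p, ⟨fun a ha b hb hab => ?_, fun i => ?_⟩, fun a ha ha0 => ?_, fun a => ?_⟩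
  · have := hp a (hmem a ha) b (hmem b hb) hab
    simp only [LinearMap.smul_apply, smul_eq_mul]
    linarith
  · have := hp' (B.degree i) (Finset.mem_union_right _ (Finset.mem_image_of_mem _
      (Finset.mem_univ i))) (by simp [degree_eq, weight])
    simp only [LinearMap.smul_apply, smul_eq_mul]
    linarith
  · have h1 : 0 < a.1 := by
      obtain ⟨k, α, -, rfl⟩ := ha
      rw [weight_degree_fst]
      refine Int.natCast_pos.2 (Nat.pos_of_ne_zero fun h0 => ha0 ?_)
      rw [B.eq_zero_of_weight_eq_zero h0, map_zero]
    have := hp' a (hmem a ha) h1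
    simp only [LinearMap.smul_apply, smul_eq_mul]
    omega
  · exact ⟨p a, by simp [two_mul]⟩

end SagbiBasis.Relations

/-! ### The ideal of the family -/

namespace SagbiBasis

open ProjectiveVariety

variable {N n : ℕ} {V : ProjectiveVariety N} {v : LatticeValuation n V.functionField}
  {h : V.piece 1} (B : SagbiBasis V v h)

/-- The homomorphism `A[t] → R[t]`, `x_{ij} ↦ t ^ w_{ij} f_{ij}`, `t ↦ t`. -/
def reesMap (p : (ℤ × (Fin n → ℤ)) →ₗ[ℤ] ℤ) :
    Polynomial (MvPolynomial B.Index ℂ) →ₐ[ℂ] Polynomial V.coordRing :=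
  (aeval fun o : Option B.Index => o.elim Polynomial.X fun i =>
    Polynomial.monomial (p (B.degree i)).toNat (B.elt i)).comp
      (optionEquivLeft ℂ B.Index).symm.toAlgHom

/-- The homogenization with respect to `t` of a polynomial: `x ^ α` is multiplied by
`t ^ (l - w · α)`. -/
def homogenize (p : (ℤ × (Fin n → ℤ)) →ₗ[ℤ] ℤ) (l : ℤ) :
    MvPolynomial B.Index ℂ →ₗ[ℂ] Polynomial (MvPolynomial B.Index ℂ) :=
  (basisMonomials B.Index ℂ).constr ℂ fun α =>
    Polynomial.monomial (l - p (Finsupp.weight B.degree α)).toNat (monomial α 1)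

theorem homogenize_monomial (p : (ℤ × (Fin n → ℤ)) →ₗ[ℤ] ℤ) (l : ℤ) (α : B.Index →₀ ℕ) (c : ℂ) :
    B.homogenize p l (monomial α c) =
      Polynomial.monomial (l - p (Finsupp.weight B.degree α)).toNat (monomial α c) := by
  have h1 : monomial α c = c • basisMonomials B.Index ℂ α := by
    simp [coe_basisMonomials, smul_monomial]
  rw [h1, map_smul, homogenize, Module.Basis.constr_basis, Polynomial.smul_monomial,
    coe_basisMonomials]

theorem homogenize_apply (p : (ℤ × (Fin n → ℤ)) →ₗ[ℤ] ℤ) (l : ℤ) (F : MvPolynomial B.Index ℂ) :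
    B.homogenize p l F = ∑ α ∈ F.support,
      Polynomial.monomial (l - p (Finsupp.weight B.degree α)).toNat (monomial α (F.coeff α)) := by
  conv_lhs => rw [F.as_sum]
  simp only [map_sum, homogenize_monomial]

theorem homogenize_of_isWeightedHomogeneous (p : (ℤ × (Fin n → ℤ)) →ₗ[ℤ] ℤ)
    {F : MvPolynomial B.Index ℂ} {d : ℤ × (Fin n → ℤ)} (hF : IsWeightedHomogeneous B.degree F d) :
    B.homogenize p (p d) F = Polynomial.C F := by
  rw [homogenize_apply]
  conv_rhs => rw [F.as_sum]
  rw [map_sum]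
  refine Finset.sum_congr rfl fun α hα => ?_
  rw [hF (mem_support_iff.1 hα), sub_self, Int.toNat_zero, Polynomial.monomial_zero_left]

/-! ### The Rees map on monomials and homogenizations -/

section Nonneg

variable {p : (ℤ × (Fin n → ℤ)) →ₗ[ℤ] ℤ} (hp : ∀ i, 0 ≤ p (B.degree i))
include hp

theorem weight_nonneg (α : B.Index →₀ ℕ) : 0 ≤ p (Finsupp.weight B.degree α) := by
  rw [Finsupp.weight_apply, Finsupp.sum, map_sum]
  refine Finset.sum_nonneg fun i _ => ?_
  rw [map_nsmul]
  exact nsmul_nonneg (hp i) _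

theorem reesMap_C_monomial (α : B.Index →₀ ℕ) :
    B.reesMap p (Polynomial.C (monomial α 1)) =
      Polynomial.monomial (p (Finsupp.weight B.degree α)).toNat (B.monomialValue α) := by
  have hzero : B.monomialValue 0 = 1 := by simp [monomialValue]
  have hone : B.reesMap p (Polynomial.C (monomial 0 1)) = 1 := by
    rw [monomial_zero', C_1, map_one, map_one]
  induction α using Finsupp.induction_linear with
  | zero => rw [hone, hzero]; simp
  | add α β hα hβ =>
    have h1 : monomial (α + β) (1 : ℂ) = monomial α 1 * monomial β 1 := by
      rw [monomial_mul, one_mul]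
    rw [h1, map_mul, map_mul, hα, hβ, Polynomial.monomial_mul_monomial, monomialValue_add,
      map_add, map_add, Int.toNat_add (B.weight_nonneg hp α) (B.weight_nonneg hp β)]
  | single i k =>
    induction k with
    | zero => rw [Finsupp.single_zero, hone, hzero]; simp
    | succ k ih =>
      have h1 : monomial (Finsupp.single i (k + 1)) (1 : ℂ) =
          monomial (Finsupp.single i k) 1 * X i := by
        rw [X, monomial_mul, one_mul, Finsupp.single_add]
      have h2 : B.reesMap p (Polynomial.C (X i)) =
          Polynomial.monomial (p (B.degree i)).toNat (B.elt i) := by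
        simp [reesMap]
      have hd : Finsupp.weight B.degree (Finsupp.single i 1) = B.degree i := by
        simp [Finsupp.weight_apply]
      rw [h1, map_mul, map_mul, ih, h2, Polynomial.monomial_mul_monomial, Finsupp.single_add,
        monomialValue_add, monomialValue_single_one, map_add, map_add, hd,
        Int.toNat_add (B.weight_nonneg hp _) (hp i)]

theorem reesMap_monomial (q : ℕ) (α : B.Index →₀ ℕ) (c : ℂ) :
    B.reesMap p (Polynomial.monomial q (monomial α c)) =
      Polynomial.monomial (q + (p (Finsupp.weight B.degree α)).toNat)
        (c • B.monomialValue α) := by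
  have h1 : Polynomial.monomial q (monomial α c) =
      c • (Polynomial.C (monomial α 1) * Polynomial.X ^ q) := by
    rw [Polynomial.C_mul_X_pow_eq_monomial, Polynomial.smul_monomial, smul_monomial, smul_eq_mul, mul_one]
  have h2 : B.reesMap p Polynomial.X = Polynomial.X := by simp [reesMap]
  rw [h1, map_smul, map_mul, map_pow, h2, B.reesMap_C_monomial hp, Polynomial.X_pow_eq_monomial,
    Polynomial.monomial_mul_monomial, mul_one, Polynomial.smul_monomial, add_comm q]

/-- The exponents `l - w·α` and `w·α` add up to `l`, so every term lands in `t ^ l`. The bound `hF`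
makes the truncation by `toNat` harmless. -/
theorem reesMap_homogenize {l : ℤ} {F : MvPolynomial B.Index ℂ}
    (hF : ∀ α ∈ F.support, p (Finsupp.weight B.degree α) ≤ l) :
    B.reesMap p (B.homogenize p l F) = Polynomial.monomial l.toNat (aeval B.elt F) := by
  rw [homogenize_apply, aeval_elt, map_sum, map_sum]
  refine Finset.sum_congr rfl fun α hα => ?_
  rw [B.reesMap_monomial hp]
  have h1 := hF α hα
  have h2 := B.weight_nonneg hp α
  have h3 : (l - p (Finsupp.weight B.degree α)).toNat + (p (Finsupp.weight B.degree α)).toNat =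
      l.toNat := by omega
  rw [h3]

end Nonneg

/-- Monomials `t ^ q` times linearly independent elements are linearly independent. -/
theorem _root_.LinearIndependent.polynomial_monomial {ι R : Type*} [CommRing R] [Algebra ℂ R]
    {b : ι → R} (hb : LinearIndependent ℂ b) (e : ι → ℕ) :
    LinearIndependent ℂ fun x : ℕ × ι => Polynomial.monomial (x.1 + e x.2) (b x.2) := by
  classical
  rw [linearIndependent_iff'] at hb ⊢
  rintro s c hsum ⟨q, i⟩ hqi
  -- Compare coefficients of `t ^ (q + e i)`. Each index `j` contributes at most once, with
  -- `t`-exponent `q + e i - e j`, so what remains is a relation among the `b j`.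
  have h1 := congrArg (fun P => Polynomial.coeff P (q + e i)) hsum
  simp only [Polynomial.finsetSum_coeff, Polynomial.coeff_smul, Polynomial.coeff_monomial,
    Polynomial.coeff_zero, smul_ite, smul_zero] at h1
  rw [← Finset.sum_filter] at h1
  set t := s.filter fun x => x.1 + e x.2 = q + e i with ht
  have hinj : Set.InjOn Prod.snd (t : Set (ℕ × ι)) := by
    rintro ⟨a, j⟩ hx ⟨b, j'⟩ hy (rfl : j = j')
    simp only [ht, Finset.coe_filter, Set.mem_ofPred_eq] at hx hy
    have : a = b := by omega
    rw [this]
  have h2 : ∑ j ∈ t.image Prod.snd, c (q + e i - e j, j) • b j = 0 := by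
    rw [Finset.sum_image hinj, ← h1]
    refine Finset.sum_congr rfl fun x hx => ?_
    have hx' := (Finset.mem_filter.1 hx).2
    have : q + e i - e x.2 = x.1 := by omega
    rw [this]
  have h3 := hb _ (fun j => c (q + e i - e j, j)) h2 i
    (Finset.mem_image.2 ⟨(q, i), Finset.mem_filter.2 ⟨hqi, rfl⟩, rfl⟩)
  simpa using h3

/-! ### The deformed relations generate the kernel of the Rees map -/

namespace Relations

variable {B} (D : B.Relations)

theorem deformed_eq (p : (ℤ × (Fin n → ℤ)) →ₗ[ℤ] ℤ) (k : Fin D.q) :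
    D.deformed p k = B.homogenize p (p (D.deg k)) (D.g k) := by
  rw [deformed, homogenize_apply]
  refine Finset.sum_congr rfl fun α _ => ?_
  rw [Finsupp.weight_apply, Finsupp.sum, Finsupp.sum, map_sum]
  simp only [map_nsmul]
  simp only [nsmul_eq_mul]

section

variable {p : (ℤ × (Fin n → ℤ)) →ₗ[ℤ] ℤ} (hp : D.IsWeightProjection p)
include hp

theorem IsWeightProjection.lt {k : Fin D.q} {α : B.Index →₀ ℕ}
    (hα : α ∈ (D.g k - D.gbar k).support) : p (Finsupp.weight B.degree α) < p (D.deg k) :=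
  hp.1 _ (D.weight_mem_of_mem_support_sub hα) _ (D.deg_mem k) (D.g_lower k α hα)

theorem reesMap_deformed (k : Fin D.q) : B.reesMap p (D.deformed p k) = 0 := by
  rw [deformed_eq, B.reesMap_homogenize hp.2, D.aeval_g, map_zero]
  intro α hα
  rcases D.mem_support_g_or hα with h1 | h1
  · rw [h1]
  · exact (hp.1 _ ⟨k, α, hα, rfl⟩ _ (D.deg_mem k) h1).le

end

/-- A homogeneous element of `I_0` is a combination of monomial multiples of the generators, of the
same degree. -/
theorem mem_span_of_mem_initialIdeal {F : MvPolynomial B.Index ℂ} {s : ℤ × (Fin n → ℤ)}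
    (hF : F ∈ B.initialIdeal) (hFs : IsWeightedHomogeneous B.degree F s) :
    F ∈ Submodule.span ℂ {G | ∃ (β : B.Index →₀ ℕ) (k : Fin D.q),
      Finsupp.weight B.degree β + D.deg k = s ∧ G = monomial β 1 * D.gbar k} := by
  classical
  rw [← D.span_gbar, Ideal.mem_span_range_iff_exists_fun] at hF
  obtain ⟨c, rfl⟩ := hF
  -- Project an arbitrary expression of `F` through the generators to degree `s`: each monomial
  -- multiple of a `gbar k` is homogeneous, so it survives or disappears as a whole.
  have h1 := weightedHomogeneousComponent_of_mem (m := s) hFs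
  rw [if_pos rfl] at h1
  rw [← h1, map_sum]
  refine Submodule.sum_mem _ fun k _ => ?_
  rw [(c k).as_sum, Finset.sum_mul, map_sum]
  refine Submodule.sum_mem _ fun β _ => ?_
  have h2 : monomial β ((c k).coeff β) * D.gbar k =
      (c k).coeff β • (monomial β 1 * D.gbar k) := by
    rw [← smul_mul_assoc, smul_monomial, smul_eq_mul, mul_one]
  have h3 : monomial β 1 * D.gbar k ∈ weightedHomogeneousSubmodule ℂ B.degree
      (Finsupp.weight B.degree β + D.deg k) :=
    (isWeightedHomogeneous_monomial B.degree β 1 rfl).mul (D.gbar_homogeneous k)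
  rw [h2, map_smul, weightedHomogeneousComponent_of_mem h3]
  refine Submodule.smul_mem _ _ ?_
  split_ifs with h4
  · exact Submodule.subset_span ⟨β, k, h4.symm, rfl⟩
  · exact zero_mem _

/-- The ideal of the deformed relations. -/
def familyIdeal (p : (ℤ × (Fin n → ℤ)) →ₗ[ℤ] ℤ) : Ideal (Polynomial (MvPolynomial B.Index ℂ)) :=
  Ideal.span (Set.range (D.deformed p))

/-- Modulo the deformed relations, `A[t]` is spanned over `ℂ[t]` by any choice of one monomial for
each degree. -/
theorem monomial_mem_familyIdeal_sup (hv : v.HasOneDimLeaves) (hh : h ≠ 0)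
    {p : (ℤ × (Fin n → ℤ)) →ₗ[ℤ] ℤ} (hp : D.IsWeightProjection p)
    {σ : Set.range (Finsupp.weight (R := ℕ) B.degree) → B.Index →₀ ℕ}
    (hσ : ∀ s, Finsupp.weight B.degree (σ s) = s) (α : B.Index →₀ ℕ) (q : ℕ) (c : ℂ) :
    Polynomial.monomial q (monomial α c) ∈ (D.familyIdeal p).restrictScalars ℂ ⊔
      Submodule.span ℂ (Set.range fun x : ℕ × Set.range (Finsupp.weight (R := ℕ) B.degree) =>
        Polynomial.monomial x.1 (monomial (σ x.2) (1 : ℂ))) := by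
  set M := (D.familyIdeal p).restrictScalars ℂ ⊔
      Submodule.span ℂ (Set.range fun x : ℕ × Set.range (Finsupp.weight (R := ℕ) B.degree) =>
        Polynomial.monomial x.1 (monomial (σ x.2) (1 : ℂ))) with hM
  -- Induction on the weight of `x ^ α`, with the power of `t` left free since rewriting may raise
  -- it.
  induction he : (p (Finsupp.weight B.degree α)).toNat using Nat.strong_induction_on
    generalizing α q c with
  | _ e ih =>
  have hone : ∀ (α : B.Index →₀ ℕ) (q : ℕ) (c : ℂ), Polynomial.monomial q (monomial α c) =
      c • Polynomial.monomial q (monomial α (1 : ℂ)) := by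
    intro α q c
    rw [Polynomial.smul_monomial, smul_monomial, smul_eq_mul, mul_one]
  let s : Set.range (Finsupp.weight (R := ℕ) B.degree) := ⟨_, α, rfl⟩
  have hs : Finsupp.weight B.degree (σ s) = Finsupp.weight B.degree α := hσ s
  -- a binomial of the same degree in the initial ideal
  obtain ⟨d, hd, hd'⟩ : ∃ d : ℂ, d ≠ 0 ∧
      monomial α 1 - monomial (σ s) d ∈ B.initialIdeal := by
    set m := Finsupp.weight B.weight α with hm
    have h1 := B.weight_degree_eq hh α
    rw [h1, B.weight_degree_eq_iff hh] at hs
    have h2 := B.monomialValue_mem hh (σ s)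
    rw [hs.1] at h2
    obtain ⟨d, hd, hd'⟩ := exists_sub_smul v hh hv h2 (B.monomialValue_mem hh α)
      (B.monomialValue_ne_zero hh _) (B.monomialValue_ne_zero hh _) hs.2
    refine ⟨d, hd, Ideal.subset_span ⟨m, V.value v h m (B.monomialValue α), ?_, ?_⟩⟩
    · exact (weightedHomogeneousSubmodule ℂ B.degree _).sub_mem
        (isWeightedHomogeneous_monomial _ _ _ h1)
        (isWeightedHomogeneous_monomial _ _ _ ((B.weight_degree_eq_iff hh).2 hs))
    · rw [B.initialIdeal_generator_iff hh, map_sub, aeval_monomial_elt, aeval_monomial_elt,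
        one_smul]
      exact ⟨sub_mem (B.monomialValue_mem hh α) (Submodule.smul_mem _ _ h2), hd'⟩
  have hmem := D.mem_span_of_mem_initialIdeal hd' (s := Finsupp.weight B.degree α)
    ((weightedHomogeneousSubmodule ℂ B.degree _).sub_mem
      (isWeightedHomogeneous_monomial _ _ _ rfl) (isWeightedHomogeneous_monomial _ _ _ hs))
  have key : ∀ F ∈ Submodule.span ℂ {G | ∃ (β : B.Index →₀ ℕ) (k : Fin D.q),
      Finsupp.weight B.degree β + D.deg k = Finsupp.weight B.degree α ∧
        G = monomial β 1 * D.gbar k}, Polynomial.monomial q F ∈ M := by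
    intro F hF
    induction hF using Submodule.span_induction with
    | zero => rw [map_zero]; exact zero_mem _
    | add F G _ _ hF hG => rw [map_add]; exact add_mem hF hG
    | smul c F _ hF => rw [← Polynomial.smul_monomial]; exact Submodule.smul_mem _ _ hF
    | mem F hF =>
      obtain ⟨β, k, hβ, rfl⟩ := hF
      have h1 : D.deformed p k = Polynomial.C (D.gbar k) +
          B.homogenize p (p (D.deg k)) (D.g k - D.gbar k) := by
        rw [deformed_eq, map_sub,
          B.homogenize_of_isWeightedHomogeneous p (D.gbar_homogeneous k)]
        ring
      -- Replace `gbar k` by the deformed relation minus its tail. The `x`-part of every tail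
      -- monomial has weight strictly below that of `x ^ α`, so the induction hypothesis applies.
      have h2 : Polynomial.monomial q (monomial β 1 * D.gbar k) =
          Polynomial.monomial q (monomial β (1 : ℂ)) * D.deformed p k -
            Polynomial.monomial q (monomial β (1 : ℂ)) *
              B.homogenize p (p (D.deg k)) (D.g k - D.gbar k) := by
        rw [h1, mul_add, add_sub_cancel_right, Polynomial.monomial_mul_C]
      rw [h2]
      refine sub_mem (Submodule.mem_sup_left ?_) ?_
      · exact Ideal.mul_mem_left _ _ (Ideal.subset_span ⟨k, rfl⟩)
      · rw [homogenize_apply, Finset.mul_sum]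
        refine Submodule.sum_mem _ fun γ hγ => ?_
        rw [Polynomial.monomial_mul_monomial, monomial_mul]
        refine ih _ ?_ _ _ _ rfl
        have h3 := hp.lt D hγ
        have h4 := congrArg p hβ
        have h5 := B.weight_nonneg hp.2 β
        have h6 := B.weight_nonneg hp.2 γ
        rw [map_add] at h4
        rw [map_add, map_add, ← he]
        omega
  have h1 := key _ hmem
  rw [map_sub, hone (σ s) q d] at h1
  have h2 : Polynomial.monomial q (monomial (σ s) (1 : ℂ)) ∈ M :=
    Submodule.mem_sup_right (Submodule.subset_span ⟨(q, s), rfl⟩)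
  have h3 := add_mem h1 (Submodule.smul_mem _ d h2)
  rw [sub_add_cancel] at h3
  rw [hone]
  exact Submodule.smul_mem _ _ h3

/-- The ideal of the deformed relations is the kernel of `A[t] → R[t]`. -/
theorem mem_familyIdeal_of_reesMap_eq_zero (hv : v.HasOneDimLeaves) (hh : h ≠ 0)
    {p : (ℤ × (Fin n → ℤ)) →ₗ[ℤ] ℤ} (hp : D.IsWeightProjection p)
    {F : Polynomial (MvPolynomial B.Index ℂ)} (hF : B.reesMap p F = 0) :
    F ∈ D.familyIdeal p := by
  choose σ hσ using fun s : Set.range (Finsupp.weight (R := ℕ) B.degree) => s.2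
  have hker : ∀ G ∈ D.familyIdeal p, B.reesMap p G = 0 := by
    have : D.familyIdeal p ≤ RingHom.ker (B.reesMap p) := by
      refine Ideal.span_le.2 ?_
      rintro _ ⟨k, rfl⟩
      exact D.reesMap_deformed hp k
    exact this
  have hmem : F ∈ (D.familyIdeal p).restrictScalars ℂ ⊔
      Submodule.span ℂ (Set.range fun x : ℕ × Set.range (Finsupp.weight (R := ℕ) B.degree) =>
        Polynomial.monomial x.1 (monomial (σ x.2) (1 : ℂ))) := by
    rw [F.as_sum_support]
    refine Submodule.sum_mem _ fun q _ => ?_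
    rw [(F.coeff q).as_sum, map_sum]
    exact Submodule.sum_mem _ fun α _ => D.monomial_mem_familyIdeal_sup hv hh hp hσ α q _
  -- Here `G` lies in the ideal and `H` combines chosen monomials. The images of the latter are
  -- powers of `t` times elements with distinct degree and value, so `H` must vanish.
  obtain ⟨G, hG, H, hH, rfl⟩ := Submodule.mem_sup.1 hmem
  rw [map_add, hker G hG, zero_add] at hF
  obtain ⟨c, rfl⟩ := Finsupp.mem_span_range_iff_exists_finsupp.1 hH
  have hind : LinearIndependent ℂ fun s => B.monomialValue (σ s) := by
    refine linearIndependent_of_value v hh (fun s => Finsupp.weight B.weight (σ s)) _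
      (fun s => B.monomialValue_mem hh _) (fun s => B.monomialValue_ne_zero hh _) fun s s' hss => ?_
    rw [Prod.mk.injEq] at hss
    apply Subtype.ext
    rw [← hσ s, ← hσ s', B.weight_degree_eq hh, B.weight_degree_eq hh]
    rw [Prod.mk.injEq]
    exact ⟨congrArg _ hss.1, hss.2⟩
  have hind' := hind.polynomial_monomial fun s => (p (s : ℤ × (Fin n → ℤ))).toNat
  rw [linearIndependent_iff] at hind'
  have hc : c = 0 := by
    apply hind'
    rw [Finsupp.linearCombination_apply, ← hF, Finsupp.sum, Finsupp.sum, map_sum]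
    refine Finset.sum_congr rfl fun x _ => ?_
    rw [map_smul, B.reesMap_monomial hp.2, hσ, one_smul]
  rw [hc, Finsupp.sum_zero_index, add_zero]
  exact hG

end Relations

end SagbiBasis

/-! ### Tangent vectors as homomorphisms to the dual numbers -/

section Tangent

variable {σ : Type} (z : Option σ → ℂ)

/-- The tangent vector `∂ / ∂ t` at the point `(z, 0)`: the homomorphism `F ↦ F (z, ε)`. -/
def verticalTangent : MvPolynomial (Option σ) ℂ →ₐ[ℂ] DualNumber ℂ :=
  aeval fun o : Option σ => o.elim DualNumber.eps fun i => algebraMap ℂ (DualNumber ℂ) (z (some i))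

theorem fst_verticalTangent (hz : z none = 0) (F : MvPolynomial (Option σ) ℂ) :
    (verticalTangent z F).fst = eval z F := by
  have : (TrivSqZeroExt.fstHom ℂ ℂ ℂ).comp (verticalTangent z) = aeval z := by
    refine algHom_ext fun o => ?_
    cases o with
    | none => simp [verticalTangent, hz]
    | some i => simp [verticalTangent, TrivSqZeroExt.algebraMap_eq_inl]
  have h1 := DFunLike.congr_fun this F
  rwa [aeval_eq_eval] at h1

/-- Since `ε² = 0`, only the coefficients of `1` and `t` contribute to `G(z, ε)`. -/
theorem verticalTangent_optionEquivLeft_symm_eq_zero {G : Polynomial (MvPolynomial σ ℂ)}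
    (h0 : eval (fun i => z (some i)) (G.coeff 0) = 0) (h1 : G.coeff 1 = 0) :
    verticalTangent z ((optionEquivLeft ℂ σ).symm G) = 0 := by
  set θ := (verticalTangent z).comp (optionEquivLeft ℂ σ).symm.toAlgHom with hθ
  show θ G = 0
  have hX : θ Polynomial.X = DualNumber.eps := by simp [hθ, verticalTangent]
  have hC : ∀ a : MvPolynomial σ ℂ, θ (Polynomial.C a) =
      algebraMap ℂ (DualNumber ℂ) (eval (fun i => z (some i)) a) := by
    intro a
    have : θ.comp (Polynomial.CAlgHom (R := ℂ)) =
        (Algebra.ofId ℂ (DualNumber ℂ)).comp (aeval fun i => z (some i)) := by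
      refine algHom_ext fun i => ?_
      simp [hθ, verticalTangent, Algebra.ofId_apply]
    have h2 := DFunLike.congr_fun this a
    simpa [Algebra.ofId_apply, coe_aeval_eq_eval] using h2
  rw [← Polynomial.divX_mul_X_add G, ← Polynomial.divX_mul_X_add G.divX]
  have h2 : G.divX.coeff 0 = 0 := by rw [Polynomial.coeff_divX]; exact h1
  rw [h2, map_zero, add_zero]
  simp only [map_add, map_mul, hX, hC, h0, map_zero, add_zero, mul_assoc, DualNumber.eps_mul_eps,
    mul_zero]

variable (hz : z none = 0)
include hz

/-- The tangent vector `∂ / ∂ t` on the local ring of affine space. -/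
def localVerticalTangent : Localization.AtPrime (pointIdeal z) →+* DualNumber ℂ :=
  IsLocalization.lift (M := (pointIdeal z).primeCompl) (g := (verticalTangent z).toRingHom)
    fun F => by
      rw [TrivSqZeroExt.isUnit_iff_isUnit_fst]
      have h1 : (verticalTangent z F).fst ≠ 0 := by
        rw [fst_verticalTangent z hz]
        exact F.2
      exact isUnit_iff_ne_zero.2 h1

theorem localVerticalTangent_algebraMap (F : MvPolynomial (Option σ) ℂ) :
    localVerticalTangent z hz (algebraMap _ _ F) = verticalTangent z F :=
  IsLocalization.lift_eq _ F

/-- A nonunit of the homogeneous localization stays a nonunit in the full one, whose maximal ideal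
is generated by polynomials vanishing at `z`. -/
theorem fst_localVerticalTangent {m : Option σ → ℕ} {a : AmbientLocalRing m z}
    (ha : a ∈ IsLocalRing.maximalIdeal (AmbientLocalRing m z)) :
    (localVerticalTangent z hz
      (algebraMap (AmbientLocalRing m z) (Localization.AtPrime (pointIdeal z)) a)).fst = 0 := by
  have h1 : algebraMap (AmbientLocalRing m z) (Localization.AtPrime (pointIdeal z)) a ∈
      IsLocalRing.maximalIdeal (Localization.AtPrime (pointIdeal z)) := by
    rw [IsLocalRing.mem_maximalIdeal, mem_nonunits_iff] at ha ⊢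
    exact fun hu => ha ((HomogeneousLocalization.isUnit_iff_isUnit_val _ _ a).1 hu)
  rw [← Localization.AtPrime.map_eq_maximalIdeal] at h1
  have h2 : (pointIdeal z).map (algebraMap _ (Localization.AtPrime (pointIdeal z))) ≤
      RingHom.ker ((TrivSqZeroExt.fstHom ℂ ℂ ℂ).toRingHom.comp (localVerticalTangent z hz)) := by
    refine Ideal.map_le_iff_le_comap.2 fun F hF => ?_
    rw [Ideal.mem_comap, RingHom.mem_ker]
    show (localVerticalTangent z hz (algebraMap _ _ F)).fst = 0
    rw [localVerticalTangent_algebraMap, fst_verticalTangent z hz]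
    exact hF
  exact h2 h1

omit hz in
theorem algebraMap_regularGerm {m : Option σ → ℕ} (F : weightedHomogeneousSubmodule ℂ m 0) :
    algebraMap (AmbientLocalRing m z) (Localization.AtPrime (pointIdeal z)) (regularGerm m z F) =
      algebraMap (MvPolynomial (Option σ) ℂ) (Localization.AtPrime (pointIdeal z)) F := by
  rw [← Localization.mk_one_eq_algebraMap]
  exact HomogeneousLocalization.val_mk _

/-- If `∂ / ∂ t` kills the ideal of `Z`, then `t` is not in the square of the maximal ideal. -/
theorem mk_parameterAt_notMem {m : σ → ℕ} {Z : Set (Option σ → ℂ)}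
    (hZ : ∀ F ∈ vanishingIdeal ℂ Z, verticalTangent z F = 0) :
    Ideal.Quotient.mk (germIdeal (extendedWeight m) Z z)
        (regularGerm (extendedWeight m) z (parameterAt m z)) ∉
      ((IsLocalRing.maximalIdeal (AmbientLocalRing (extendedWeight m) z)).map
        (Ideal.Quotient.mk (germIdeal (extendedWeight m) Z z))) ^ 2 := by
  rw [← Ideal.map_pow, Ideal.mem_quotient_iff_mem_sup]
  set χ := (localVerticalTangent z hz).comp
    (algebraMap (AmbientLocalRing (extendedWeight m) z) (Localization.AtPrime (pointIdeal z)))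
    with hχ
  -- Products of two multiples of `ε` vanish, which disposes of the square of the maximal ideal;
  -- germs vanishing on `Z` die by `hZ`. But `t` goes to `ε`.
  have hle : IsLocalRing.maximalIdeal (AmbientLocalRing (extendedWeight m) z) ^ 2 ⊔
      germIdeal (extendedWeight m) Z z ≤ RingHom.ker χ := by
    refine sup_le ?_ ?_
    · rw [pow_two, Ideal.mul_le]
      intro a ha b hb
      have ha' : (χ a).fst = 0 := fst_localVerticalTangent z hz ha
      have hb' : (χ b).fst = 0 := fst_localVerticalTangent z hz hb
      rw [RingHom.mem_ker, map_mul]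
      ext <;> simp [ha', hb']
    · have h1 : (vanishingIdeal ℂ Z).map (algebraMap (MvPolynomial (Option σ) ℂ)
          (Localization.AtPrime (pointIdeal z))) ≤ RingHom.ker (localVerticalTangent z hz) := by
        refine Ideal.map_le_iff_le_comap.2 fun F hF => ?_
        rw [Ideal.mem_comap, RingHom.mem_ker, localVerticalTangent_algebraMap]
        exact hZ F hF
      intro a ha
      exact h1 ha
  intro hmem
  have h1 : χ (regularGerm (extendedWeight m) z (parameterAt m z)) = 0 := hle hmem
  have h2 : χ (regularGerm (extendedWeight m) z (parameterAt m z)) =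
      localVerticalTangent z hz (algebraMap (MvPolynomial (Option σ) ℂ)
        (Localization.AtPrime (pointIdeal z)) (X none - C (z none))) := by
    rw [hχ, RingHom.comp_apply, algebraMap_regularGerm]
    rfl
  rw [h2, localVerticalTangent_algebraMap, hz, C_0, sub_zero] at h1
  have h3 := congrArg TrivSqZeroExt.snd h1
  simp [verticalTangent] at h3

end Tangent

/-! ### Points of the family -/

namespace SagbiBasis.Relations

open ProjectiveVariety

variable {N n : ℕ} {V : ProjectiveVariety N} {v : LatticeValuation n V.functionField}
  {h : V.piece 1} {B : SagbiBasis V v h} (D : B.Relations)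

/-- The value of `h` itself lies in `S`, so the generating family is not empty. -/
theorem nonempty_index (hh : h ≠ 0) (B : SagbiBasis V v h) : Nonempty B.Index := by
  have h1 := mem_valueSemigroup v (h := h) one_pos h.2 (by simpa using hh)
  rw [← B.closure_eq] at h1
  by_contra hempty
  rw [not_nonempty_iff] at hempty
  have h2 := Set.range_eq_empty
    fun ij : Σ i : Fin B.r, Fin (B.size i) => V.gradedValue v h (B.basis ij.1 ij.2)
  rw [h2, AddSubsemigroup.closure_empty] at h1
  exact h1

/-- A polynomial with coefficients in `R` that vanishes at all points of the cone over `X` where a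
given nonzero element `a` of `R` does not vanish, and at all nonzero `t`, is zero. -/
theorem eq_zero_of_forall_eval_eq_zero {P : Polynomial V.coordRing} {a : V.coordRing} (ha : a ≠ 0)
    (hP : ∀ (y : V.coordRing →ₐ[ℂ] ℂ) (t : ℂ), y a ≠ 0 → t ≠ 0 →
      Polynomial.eval t (P.map y.toRingHom) = 0) : P = 0 := by
  -- The factor `a t` extends the vanishing to the excluded points. The Nullstellensatz for the
  -- prime ideal of `V` then kills every coefficient, and `R[t]` is a domain.
  have hQ : P * (Polynomial.C a * Polynomial.X) = 0 := by
    ext i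
    rw [Polynomial.coeff_zero]
    obtain ⟨G, hG⟩ := Ideal.Quotient.mk_surjective
      ((P * (Polynomial.C a * Polynomial.X)).coeff i)
    rw [← hG, Ideal.Quotient.eq_zero_iff_mem,
      ← MvPolynomial.IsPrime.vanishingIdeal_zeroLocus (K := ℂ) V.ideal, mem_vanishingIdeal_iff]
    intro x hx
    rw [mem_zeroLocus_iff] at hx
    let y : V.coordRing →ₐ[ℂ] ℂ := Ideal.Quotient.liftₐ V.ideal (aeval x) hx
    have h1 : (P * (Polynomial.C a * Polynomial.X)).map y.toRingHom = 0 := by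
      refine Polynomial.funext fun t => ?_
      simp only [Polynomial.map_mul, Polynomial.map_C, Polynomial.map_X, Polynomial.eval_mul,
        Polynomial.eval_C, Polynomial.eval_X, Polynomial.eval_zero]
      by_cases hya : y a = 0
      · have : y.toRingHom a = 0 := hya
        rw [this]; ring
      by_cases ht : t = 0
      · rw [ht]; ring
      rw [hP y t hya ht, zero_mul]
    have h2 := congrArg (fun Q => Polynomial.coeff Q i) h1
    simp only [Polynomial.coeff_map, Polynomial.coeff_zero, ← hG] at h2
    exact h2
  refine (mul_eq_zero.1 hQ).resolve_right (mul_ne_zero ?_ Polynomial.X_ne_zero)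
  exact Polynomial.C_ne_zero.2 ha

/-- Points of the cone over `X` with `f_{i₀} ≠ 0`, together with `t ≠ 0`, give points `(t^w y(f),
t)` of the family; these conditions ensure nonzero `x`-coordinates. Evaluating the Rees image of `F`
there is evaluating `F` on the family. -/
theorem reesMap_eq_zero_of_mem_vanishingIdeal (hh : h ≠ 0) {p : (ℤ × (Fin n → ℤ)) →ₗ[ℤ] ℤ}
    (hp : D.IsWeightProjection p) {F : MvPolynomial (Option B.Index) ℂ}
    (hF : F ∈ vanishingIdeal ℂ (coneOver (D.family p))) :
    B.reesMap p (optionEquivLeft ℂ B.Index F) = 0 := by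
  obtain ⟨i₀⟩ := nonempty_index hh B
  refine eq_zero_of_forall_eval_eq_zero (B.elt_ne_zero i₀) fun y t hy ht => ?_
  let x : B.Index → ℂ := fun i => t ^ (p (B.degree i)).toNat * y (B.elt i)
  let z : Option B.Index → ℂ := fun o => o.elim t x
  have key : ∀ G : MvPolynomial (Option B.Index) ℂ, Polynomial.eval t
      ((B.reesMap p (optionEquivLeft ℂ B.Index G)).map y.toRingHom) = eval z G := by
    intro G
    have h1 : (((Polynomial.aeval t).comp (Polynomial.mapAlgHom y)).comp (B.reesMap p)).comp
        (optionEquivLeft ℂ B.Index).toAlgHom = aeval z := by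
      refine algHom_ext fun o => ?_
      cases o with
      | none => simp [reesMap, z]
      | some i => simp [reesMap, z, x, Polynomial.eval_monomial, mul_comm]
    have h2 := DFunLike.congr_fun h1 G
    rw [aeval_eq_eval] at h2
    exact h2
  rw [key, ← aeval_eq_eval]
  have hx : (fun i => z (some i)) ≠ 0 := by
    intro h0
    exact mul_ne_zero (pow_ne_zero _ ht) hy (congrFun h0 i₀)
  refine mem_vanishingIdeal_iff.1 hF z ⟨_, ⟨z, ⟨hx, rfl⟩, fun k => ?_⟩, hx, rfl⟩
  have h1 := optionEquivLeft_elim_eval ℂ B.Index x t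
    ((optionEquivLeft ℂ B.Index).symm (D.deformed p k))
  rw [AlgEquiv.apply_symm_apply] at h1
  refine h1.symm.trans ?_
  have h2 := key ((optionEquivLeft ℂ B.Index).symm (D.deformed p k))
  rw [AlgEquiv.apply_symm_apply, D.reesMap_deformed hp] at h2
  simpa using h2.symm

/-- Every exponent of `t` is a truncated difference of even integers, hence never 1. -/
theorem coeff_one_deformed {p : (ℤ × (Fin n → ℤ)) →ₗ[ℤ] ℤ} (hp : ∀ a, Even (p a))
    (k : Fin D.q) : (D.deformed p k).coeff 1 = 0 := by
  rw [deformed_eq, homogenize_apply, Polynomial.finsetSum_coeff]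
  refine Finset.sum_eq_zero fun α _ => Polynomial.coeff_monomial_of_ne _ ?_
  obtain ⟨a, ha⟩ := hp (D.deg k)
  obtain ⟨b, hb⟩ := hp (Finsupp.weight B.degree α)
  omega

/-- The deformed relations vanish on all homogeneous coordinates of points of the family. -/
theorem eval_deformed_eq_zero {p : (ℤ × (Fin n → ℤ)) →ₗ[ℤ] ℤ} {z : Option B.Index → ℂ}
    (hz : z ∈ coneOver (D.family p)) (k : Fin D.q) :
    ((D.deformed p k).map (eval fun i => z (some i))).eval (z none) = 0 := by
  obtain ⟨P, ⟨z', ⟨hx', hP'⟩, heq⟩, hx, hP⟩ := hz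
  have hP1 := congrArg Prod.fst (hP'.symm.trans hP)
  have hP2 : z' none = z none := congrArg Prod.snd (hP'.symm.trans hP)
  obtain ⟨c, -, hc⟩ := Quotient.exact hP1
  obtain ⟨d, hd⟩ := D.g_homogeneous k
  have hscale : ∀ i, z (some i) = c ^ B.weight i * z' (some i) := hc
  -- Membership in the family is witnessed by one choice of coordinates; homogeneity of `g k` in the
  -- `ℕ`-grading carries the equation to any other choice.
  have h1 : ((D.deformed p k).map (eval fun i => z (some i))).eval (z none) =
      c ^ d * ((D.deformed p k).map (eval fun i => z' (some i))).eval (z' none) := by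
    rw [← hP2, deformed_eq, homogenize_apply]
    simp only [Polynomial.map_sum, Polynomial.eval_finsetSum, Polynomial.map_monomial,
      Polynomial.eval_monomial, eval_monomial, Finset.mul_sum]
    refine Finset.sum_congr rfl fun α hα => ?_
    have h2 : α.prod (fun i e => z (some i) ^ e) =
        c ^ d * α.prod (fun i e => z' (some i) ^ e) := by
      rw [← hd (mem_support_iff.1 hα), Finsupp.weight_apply, Finsupp.sum, Finsupp.prod,
        Finsupp.prod, ← Finset.prod_pow_eq_pow_sum, ← Finset.prod_mul_distrib]
      refine Finset.prod_congr rfl fun i _ => ?_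
      rw [hscale, mul_pow, ← pow_mul, smul_eq_mul, mul_comm (α i)]
    rw [h2]
    ring
  rw [h1, heq k, mul_zero]

/-- No point of the special fibre is a critical point of the projection to the line. -/
theorem not_isCriticalPoint (hv : v.HasOneDimLeaves) (hh : h ≠ 0)
    {p : (ℤ × (Fin n → ℤ)) →ₗ[ℤ] ℤ} (hp : D.IsWeightProjection p)
    (hcoeff : ∀ k, (D.deformed p k).coeff 1 = 0) {P : WeightedProjectiveSpace B.weight × ℂ}
    (hP : P ∈ D.specialFiber p) : ¬ IsCriticalPoint (D.family p) P := by
  rintro ⟨-, z, hz, hcrit⟩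
  have hz0 : z none = 0 := by
    obtain ⟨hx, rfl⟩ := hz
    exact hP.2
  refine mk_parameterAt_notMem z hz0 (fun F hF => ?_) hcrit
  have h1 := D.mem_familyIdeal_of_reesMap_eq_zero hv hh hp
    (D.reesMap_eq_zero_of_mem_vanishingIdeal hh hp hF)
  -- It suffices that `∂/∂t` kills the generators: their constant terms vanish at `z` because the
  -- point lies in the fibre, their linear terms by `hcoeff`.
  have h2 : D.familyIdeal p ≤ RingHom.ker
      ((verticalTangent z).comp (optionEquivLeft ℂ B.Index).symm.toAlgHom) := by
    refine Ideal.span_le.2 ?_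
    rintro _ ⟨k, rfl⟩
    refine verticalTangent_optionEquivLeft_symm_eq_zero z ?_ (hcoeff k)
    have h3 := D.eval_deformed_eq_zero ⟨P, hP.1, hz⟩ k
    rwa [hz0, ← Polynomial.coeff_zero_eq_eval_zero, Polynomial.coeff_map] at h3
  have h4 : verticalTangent z ((optionEquivLeft ℂ B.Index).symm (optionEquivLeft ℂ B.Index F)) = 0 :=
    h2 h1
  rwa [AlgEquiv.symm_apply_apply] at h4

end SagbiBasis.Relations

end

theorem mainTheorem12 {N n : ℕ} (V : ProjectiveVariety N) (hsmooth : V.IsSmooth)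
    (hdim : Algebra.trdeg ℂ V.functionField = (n : Cardinal))
    (v : LatticeValuation n V.functionField) (hv : v.HasOneDimLeaves)
    (h : V.piece 1) (hh : h ≠ 0) (hS : V.FinitelyGeneratedValues v h) :
    Nonempty (SagbiBasis V v h) ∧
    ∀ B : SagbiBasis V v h, Nonempty B.Relations ∧
      ∀ D : B.Relations, ∃ p : (ℤ × (Fin n → ℤ)) →ₗ[ℤ] ℤ,
        D.IsWeightProjection p ∧
        (∀ a ∈ D.monomialDegrees, a ≠ 0 → 1 < p a) ∧
        (∀ k, (D.deformed p k).coeff 1 = 0) ∧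
        ∀ P, IsSmoothPoint (D.specialFiber p) P → ¬ IsCriticalPoint (D.family p) P := by
  refine ⟨ProjectiveVariety.nonempty_sagbiBasis v hh hv hS, fun B =>
    ⟨B.nonempty_relations hh hv, fun D => ?_⟩⟩
  obtain ⟨p, hp, hp1, heven⟩ := D.exists_even_weightProjection
  have hcoeff := D.coeff_one_deformed heven
  exact ⟨p, hp, hp1, hcoeff, fun P hP => D.not_isCriticalPoint hv hh hp hcoeff hP.1⟩
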